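/- For a simple undirected graph $G=(V,E)$ on $V=\{1,\dots,n\}$, an edge-detecting query is a set $Q\subseteq V$; its answer is YES if some edge of $G$ has both endpoints in $Q$, and NO otherwise. A learner works in rounds: in each round it asks a finite list of queries in parallel, chosen from the answers of the previous rounds and from a random seed (drawn independently of $G$), and at the end it outputs a graph. It is Las Vegas if for every target graph $G$ its output equals $G$ with probability $1$. Let $\log$ be the base-two logarithm and let $\log^* n$ be the least $k\ge 0$ such that the $k$-fold iterated logarithm of $n$ is at most $1$. Theorem. There are a constant $C>0$ and, for every $n\ge 1$, a Las Vegas randomized learner for graphs on $n$ vertices (it is given $n$, but not the number of edges) that never uses more than $\log^* n$ rounds and such that, for every $m\ge 1$ and every target graph $G$ with at most $m$ edges, the expected number of queries that it asks is at most $C\,m\log n$. -/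

import Mathlib

/-- `iteratedLog k x` is `log^[k] x`: the base-two logarithm applied `k` times to `x`. -/
noncomputable def iteratedLog (k : ℕ) (x : ℝ) : ℝ := (Real.logb 2)^[k] x

/-- Every natural number is brought to a value at most `1` by iterating the logarithm, so the
infimum that defines `logStar` is over a nonempty set. -/
theorem exists_iteratedLog_le_one (n : ℕ) : ∃ k : ℕ, iteratedLog k (n : ℝ) ≤ 1 := by
  have key : ∀ n : ℕ, ∀ x : ℝ, x ≤ n → ∃ k : ℕ, iteratedLog k x ≤ 1 := by
    intro n
    induction n with
    | zero => exact fun x hx => ⟨0, by simp only [iteratedLog, Function.iterate_zero, id]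
                                       push_cast at hx; linarith⟩
    | succ n ih =>
      intro x hx
      by_cases h1 : x ≤ 1
      · exact ⟨0, by simpa [iteratedLog] using h1⟩
      · have h1' : 1 < x := lt_of_not_ge h1
        have hlog : Real.logb 2 x ≤ n := by
          rw [Real.logb_le_iff_le_rpow (by norm_num) (by linarith), Real.rpow_natCast]
          refine hx.trans ?_
          exact_mod_cast Nat.lt_two_pow_self
        obtain ⟨k, hk⟩ := ih _ hlog
        exact ⟨k + 1, by simpa [iteratedLog, Function.iterate_succ_apply] using hk⟩
  exact key n n le_rfl

/-- The iterated logarithm `log* n`: the least `k` with `log^[k] n ≤ 1`. -/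
noncomputable def logStar (n : ℕ) : ℕ := sInf {k : ℕ | iteratedLog k (n : ℝ) ≤ 1}

open Classical in
/-- The oracle answer to the edge-detecting query `Q`: `true` (YES) if some edge of `G` has both
endpoints in `Q`, and `false` (NO) otherwise. -/
noncomputable def edgeOracle {V : Type*} (G : SimpleGraph V) (Q : Finset V) : Bool :=
  decide (∃ u ∈ Q, ∃ v ∈ Q, G.Adj u v)

/-- A deterministic learner on the vertex set `V` that works in rounds. It either stops and outputs
a graph, or it starts a round: it asks all queries of a list in parallel, and the list of answers
determines how it goes on. -/
inductive RoundLearner (V : Type*) where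
  | output (H : SimpleGraph V) : RoundLearner V
  | round (queries : List (Finset V)) (next : List Bool → RoundLearner V) : RoundLearner V

namespace RoundLearner

variable {V : Type*}

/-- The graph that the learner outputs when the target graph is `G`. -/
noncomputable def result (G : SimpleGraph V) : RoundLearner V → SimpleGraph V
  | output H => H
  | round queries next => result G (next (queries.map (edgeOracle G)))

/-- The number of rounds of the run of the learner on the target graph `G`. -/
noncomputable def numRounds (G : SimpleGraph V) : RoundLearner V → ℕ
  | output _ => 0
  | round queries next => 1 + numRounds G (next (queries.map (edgeOracle G)))

/-- The total number of queries (over all rounds, with multiplicity) asked in the run of the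
learner on the target graph `G`. -/
noncomputable def numQueries (G : SimpleGraph V) : RoundLearner V → ℕ
  | output _ => 0
  | round queries next =>
      queries.length + numQueries G (next (queries.map (edgeOracle G)))

end RoundLearner

/-- A randomized learner on the vertex set `V`: it draws a random seed, independent of the target
graph, and then runs the deterministic learner given by the seed. -/
structure RandomizedLearner (V : Type*) where
  /-- The type of seeds. -/
  Seed : Type
  /-- The distribution of the seed. -/
  law : PMF Seed
  /-- The deterministic learner that is run for a given seed. -/
  run : Seed → RoundLearner V

namespace RandomizedLearner

variable {V : Type*}

/-- Las Vegas: whatever the target graph is, the output is exactly the target graph with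
probability one. -/
def IsLasVegas (A : RandomizedLearner V) : Prop :=
  ∀ G : SimpleGraph V, ∀ s ∈ A.law.support, (A.run s).result G = G

/-- Whatever the target graph is, the learner never uses more than `r` rounds. -/
def RunsInRounds (A : RandomizedLearner V) (r : ℕ) : Prop :=
  ∀ G : SimpleGraph V, ∀ s ∈ A.law.support, (A.run s).numRounds G ≤ r

/-- The expected number of queries asked on the target graph `G`. -/
noncomputable def expectedQueries (A : RandomizedLearner V) (G : SimpleGraph V) : ENNReal :=
  ∑' s, A.law s * ((A.run s).numQueries G : ENNReal)

end RandomizedLearner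

set_option linter.unusedSectionVars false

/-! Ten rounds suffice for all `n ≥ 2`. As log* is unbounded, this settles all large `n`. For the
finitely many other `n ≥ 2`, one round asking all pairs costs at most `n ^ 2`, which `C` absorbs; `n
= 1` needs no query.

The basic tool is a four-round phase producing edgeless queries that cover all but O(m) pairs.
Random sets of density about `2^-j`, tested at every scale `j`, reveal a scale `s` at which they
seldom span an edge although `4^s = O(m)` (`four_pow_trueScale_le`). Fewer than `2·2^s` vertices can
have degree above `2^s/8` (`card_high_lt`), and about `4^s` sets at scale `s`, up to a factor `r`,
cover every non-adjacent pair of the remaining vertices. A vertex with more than `3·2^s` open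
partners must have high degree. Each such `h` gets its own scale `s_h` with `2^{s_h} = O(2^s + deg
h)`, and sets at that scale enlarged by `h` cover its pairs with low-degree non-neighbours. What
stays open is `O(m + 4^s)` pairs (`card_uncert_le_of_typical`). All estimates are right on one event
`Typical`, which fails with exponentially small probability in `r`.

With `J` and `r` of order log n the phase costs `O(m log n + √m log² n)`, too much for small `m`. It
is therefore run first on vertices hashed into polylogarithmically many classes, where `J` and `r`
are of order log log n. If the hash function is injective on non-isolated vertices, the queries act
like those of a graph on the classes. For each of the O(m) open pairs of classes, O(log n) queries
splitting a class by binary digits then leave only true edges open, provided `m` is below `log² n`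
(`uncert_step_bitRound_subset`). The phase on the vertices themselves is skipped once O(log² n)
pairs are open, so on the good event it is paid for only when `m ≥ L ^ 2`, where it is affordable.
The last round asks every open pair, so the output is always correct. Nothing depends on `m`, and in
`avg_cost_strategy_le` the failure probabilities outweigh the polynomial worst-case costs. -/

namespace EdgeQuery

open scoped Classical
open Finset

/-! ### Averages over finite uniform spaces -/

section Average

variable {Ω Ω' ι W : Type*} [Fintype Ω] [Fintype Ω']

/-- The expectation of `f` under the uniform distribution. -/
noncomputable def avg (f : Ω → ℝ) : ℝ := (∑ x, f x) / Fintype.card Ω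

/-- The probability of `p` under the uniform distribution. -/
noncomputable def prob (p : Ω → Prop) : ℝ := avg fun x => if p x then 1 else 0

theorem prob_eq_avg (p : Ω → Prop) [DecidablePred p] :
    prob p = avg fun x => if p x then 1 else 0 := by
  rw [prob]; congr!

theorem card_cast_pos [Nonempty Ω] : (0 : ℝ) < Fintype.card Ω :=
  Nat.cast_pos.2 Fintype.card_pos

theorem avg_mono {f g : Ω → ℝ} (h : ∀ x, f x ≤ g x) : avg f ≤ avg g :=
  div_le_div_of_nonneg_right (sum_le_sum fun x _ => h x) (Nat.cast_nonneg _)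

theorem avg_nonneg {f : Ω → ℝ} (h : ∀ x, 0 ≤ f x) : 0 ≤ avg f :=
  div_nonneg (sum_nonneg fun x _ => h x) (Nat.cast_nonneg _)

theorem avg_add (f g : Ω → ℝ) : avg (fun x => f x + g x) = avg f + avg g := by
  simp only [avg, sum_add_distrib, add_div]

theorem avg_mul_left (c : ℝ) (f : Ω → ℝ) : avg (fun x => c * f x) = c * avg f := by
  simp only [avg, ← mul_sum, mul_div_assoc]

theorem avg_sum (s : Finset ι) (f : ι → Ω → ℝ) :
    avg (fun x => ∑ i ∈ s, f i x) = ∑ i ∈ s, avg (f i) := by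
  simp only [avg, sum_comm (s := univ), sum_div]

theorem avg_const [Nonempty Ω] (c : ℝ) : avg (fun _ : Ω => c) = c := by
  have := card_cast_pos (Ω := Ω)
  simp only [avg, sum_const, card_univ, nsmul_eq_mul]
  field_simp

theorem avg_prod (f : Ω × Ω' → ℝ) : avg f = avg fun x => avg fun y => f (x, y) := by
  simp only [avg, Fintype.sum_prod_type, Fintype.card_prod, Nat.cast_mul, ← sum_div, div_div]
  rw [mul_comm]

theorem prob_fst [Nonempty Ω'] (p : Ω → Prop) : prob (fun x : Ω × Ω' => p x.1) = prob p := by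
  rw [prob, avg_prod]
  exact congrArg avg (funext fun x => avg_const (Ω := Ω') (if p x then 1 else 0))

theorem prob_snd [Nonempty Ω] (p : Ω' → Prop) : prob (fun x : Ω × Ω' => p x.2) = prob p := by
  rw [prob, avg_prod]
  exact avg_const (Ω := Ω) (prob p)

theorem avg_equiv (e : Ω ≃ Ω') (f : Ω' → ℝ) : avg (fun x => f (e x)) = avg f := by
  simp only [avg, e.sum_comp, Fintype.card_congr e]

theorem prob_mono {p q : Ω → Prop} (h : ∀ x, p x → q x) : prob p ≤ prob q :=
  avg_mono fun x => by
    by_cases hp : p x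
    · simp [hp, h x hp]
    · rw [if_neg hp]; split_ifs <;> norm_num

theorem prob_congr {p q : Ω → Prop} (h : ∀ x, p x ↔ q x) : prob p = prob q := by
  have : p = q := funext fun x => propext (h x)
  rw [this]

theorem prob_nonneg (p : Ω → Prop) : 0 ≤ prob p :=
  avg_nonneg fun x => by split_ifs <;> norm_num

theorem prob_true [Nonempty Ω] : prob (fun _ : Ω => True) = 1 := by
  simp only [prob, if_true, avg_const]

theorem prob_le_one [Nonempty Ω] (p : Ω → Prop) : prob p ≤ 1 :=
  (prob_mono fun _ _ => trivial).trans_eq prob_true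

theorem prob_not [Nonempty Ω] (p : Ω → Prop) : prob (fun x => ¬ p x) = 1 - prob p := by
  have h : prob (fun x => ¬ p x) + prob p = 1 := by
    rw [prob, prob, ← avg_add]
    refine Eq.trans ?_ (avg_const (Ω := Ω) 1)
    congr 1; ext x; by_cases h : p x <;> simp [h]
  linarith

theorem prob_or_le (p q : Ω → Prop) : prob (fun x => p x ∨ q x) ≤ prob p + prob q := by
  rw [prob, prob, prob, ← avg_add]
  refine avg_mono fun x => ?_
  by_cases hp : p x <;> by_cases hq : q x <;> simp [hp, hq]

theorem prob_exists_le (s : Finset ι) (p : ι → Ω → Prop) :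
    prob (fun x => ∃ i ∈ s, p i x) ≤ ∑ i ∈ s, prob (p i) := by
  simp only [prob]
  rw [← avg_sum]
  refine avg_mono fun x => ?_
  split_ifs with h
  · obtain ⟨i, hi, hp⟩ := h
    calc (1 : ℝ) = if p i x then 1 else 0 := by rw [if_pos hp]
      _ ≤ _ := single_le_sum (f := fun i => if p i x then (1 : ℝ) else 0)
        (fun j _ => by split_ifs <;> norm_num) hi
  · exact sum_nonneg fun j _ => by split_ifs <;> norm_num

/-- Union bound over a finite set of events with a common bound. -/
theorem prob_exists_le_card_mul (s : Finset ι) (p : ι → Ω → Prop) (ε : ℝ)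
    (h : ∀ i ∈ s, prob (p i) ≤ ε) : prob (fun x => ∃ i ∈ s, p i x) ≤ #s * ε :=
  (prob_exists_le s p).trans ((sum_le_sum h).trans_eq (by rw [sum_const, nsmul_eq_mul]))

theorem prob_le_div_of_le_avg (f : Ω → ℝ) (hf : ∀ x, 0 ≤ f x) {a : ℝ} (ha : 0 < a) :
    prob (fun x => a ≤ f x) ≤ avg f / a := by
  rw [le_div_iff₀ ha, mul_comm, prob, ← avg_mul_left]
  refine avg_mono fun x => ?_
  split_ifs with h
  · simpa using h
  · simpa using hf x

/-! ### Product spaces, independence and tail bounds -/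

variable [Fintype ι] [DecidableEq ι] [Fintype W] [DecidableEq W]

theorem avg_pi_prod (φ : ι → Ω → ℝ) :
    avg (fun ω : ι → Ω => ∏ i, φ i (ω i)) = ∏ i, avg (φ i) := by
  simp only [avg, prod_div_distrib, prod_univ_sum, Fintype.piFinset_univ]
  simp

/-- Exchanging the fresh value with the old one is an involution on pairs (function, value), so
resampling one coordinate preserves the uniform law. This isolates the coin of one vertex from all
others. -/
theorem avg_update [Nonempty Ω] (u : W) (F : (W → Ω) → ℝ) :
    avg F = avg fun f => avg fun x => F (Function.update f u x) := by
  have hΩ := card_cast_pos (Ω := Ω)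
  have key : ∑ f : W → Ω, ∑ x, F (Function.update f u x) = Fintype.card Ω * ∑ f, F f := by
    rw [← Fintype.sum_prod_type' (f := fun (f : W → Ω) x => F (Function.update f u x))]
    let e : (W → Ω) × Ω ≃ (W → Ω) × Ω :=
      ⟨fun p => (Function.update p.1 u p.2, p.1 u), fun p => (Function.update p.1 u p.2, p.1 u),
        fun p => by simp, fun p => by simp⟩
    rw [← e.sum_comp (fun p => F (Function.update p.1 u p.2))]
    simp only [e, Equiv.coe_fn_mk, Function.update_idem, Function.update_eq_self]
    rw [Fintype.sum_prod_type]
    simp [mul_sum]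
  simp only [avg, ← sum_div, key]
  field_simp

/-- The probability that an event depending on one coordinate misses at all indices of a set. -/
theorem prob_forall_not [Nonempty Ω] (s : Finset ι) (E : Ω → Prop) :
    prob (fun ω : ι → Ω => ∀ i ∈ s, ¬ E (ω i)) = (1 - prob E) ^ #s := by
  have h : ∀ ω : ι → Ω, (if ∀ i ∈ s, ¬ E (ω i) then (1 : ℝ) else 0)
      = ∏ i, if i ∈ s then (if ¬ E (ω i) then 1 else 0) else 1 := by
    intro ω
    rw [prod_ite_mem, univ_inter]
    split_ifs with h
    · exact (prod_eq_one fun i hi => by simp [h i hi]).symm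
    · push Not at h
      obtain ⟨i, hi, hE⟩ := h
      exact (prod_eq_zero hi (by simp [hE])).symm
  rw [prob_eq_avg]
  simp only [h]
  rw [avg_pi_prod (fun i x => if i ∈ s then (if ¬ E x then (1 : ℝ) else 0) else 1)]
  have : ∀ i, avg (fun x => if i ∈ s then (if ¬ E x then (1 : ℝ) else 0) else 1)
      = if i ∈ s then 1 - prob E else 1 := by
    intro i
    split_ifs
    · exact (prob_eq_avg _).symm.trans (prob_not E)
    · exact avg_const 1
  simp only [this]
  rw [prod_ite_mem, univ_inter, prod_const]

/-- Generating function of a binomial count. Markov's inequality with `c = 2` and `c = 1/2` gives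
the two tails. -/
theorem avg_pow_card [Nonempty Ω] (s : Finset ι) (E : Ω → Prop) (c : ℝ) :
    avg (fun ω : ι → Ω => c ^ #{i ∈ s | E (ω i)}) = (1 + (c - 1) * prob E) ^ #s := by
  have h : ∀ ω : ι → Ω, c ^ #{i ∈ s | E (ω i)}
      = ∏ i, if i ∈ s then (if E (ω i) then c else 1) else 1 := by
    intro ω
    rw [prod_ite_mem, univ_inter, prod_ite, prod_const, prod_const_one, mul_one]
  simp only [h]
  rw [avg_pi_prod (fun i x => if i ∈ s then (if E x then c else 1) else 1)]
  have : ∀ i, avg (fun x => if i ∈ s then (if E x then c else 1) else 1)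
      = if i ∈ s then 1 + (c - 1) * prob E else 1 := by
    intro i
    split_ifs
    · rw [prob, ← avg_mul_left]
      nth_rw 2 [← avg_const (Ω := Ω) 1]
      rw [← avg_add]
      congr 1; ext x; split_ifs <;> ring
    · exact avg_const 1
  simp only [this]
  rw [prod_ite_mem, univ_inter, prod_const]

theorem two_rpow_eq_exp (a : ℝ) : (2 : ℝ) ^ a = Real.exp (Real.log 2 * a) :=
  Real.rpow_def_of_pos two_pos a

/-- Upper tail: an event of probability at most `τ / 2` rarely happens more than `τ` of the time. -/
theorem prob_count_gt_le [Nonempty Ω] (s : Finset ι) (E : Ω → Prop) {τ : ℝ} (hτ : 0 ≤ τ)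
    (h : prob E ≤ τ / 2) :
    prob (fun ω : ι → Ω => τ * #s < #{i ∈ s | E (ω i)}) ≤ Real.exp (-(τ * #s / 6)) := by
  have h1 : prob (fun ω : ι → Ω => τ * #s < #{i ∈ s | E (ω i)})
      ≤ prob (fun ω : ι → Ω => (2 : ℝ) ^ (τ * #s) ≤ (2 : ℝ) ^ #{i ∈ s | E (ω i)}) :=
    prob_mono fun ω hω => by
      rw [← Real.rpow_natCast]
      exact Real.rpow_le_rpow_of_exponent_le one_le_two hω.le
  refine h1.trans ((prob_le_div_of_le_avg _ (fun ω => by positivity) (by positivity)).trans ?_)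
  rw [avg_pow_card, two_rpow_eq_exp, div_le_iff₀ (Real.exp_pos _), ← Real.exp_add]
  have h2 : 1 + (2 - 1) * prob E ≤ Real.exp (τ / 2) := by
    have := Real.add_one_le_exp (τ / 2)
    linarith
  have h0 : 0 ≤ 1 + (2 - 1) * prob E := by have := prob_nonneg E; linarith
  refine (pow_le_pow_left₀ h0 h2 _).trans ?_
  rw [← Real.exp_nat_mul, Real.exp_le_exp]
  -- The exponent per trial is `τ (1/2 - log 2)`, and `log 2 - 1/2 > 1/6`.
  have := Real.log_two_gt_d9
  have hs : 0 ≤ τ * #s := by positivity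
  nlinarith

/-- Lower tail: an event of probability at least `2 * τ` rarely happens at most `τ` of the time. -/
theorem prob_count_le_le [Nonempty Ω] (s : Finset ι) (E : Ω → Prop) {τ : ℝ} (hτ : 0 ≤ τ)
    (h : 2 * τ ≤ prob E) :
    prob (fun ω : ι → Ω => (#{i ∈ s | E (ω i)} : ℝ) ≤ τ * #s) ≤ Real.exp (-(τ * #s / 6)) := by
  have h1 : prob (fun ω : ι → Ω => (#{i ∈ s | E (ω i)} : ℝ) ≤ τ * #s)
      ≤ prob (fun ω : ι → Ω => (2 : ℝ) ^ (-(τ * #s)) ≤ (1 / 2 : ℝ) ^ #{i ∈ s | E (ω i)}) :=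
    prob_mono fun ω hω => by
      rw [one_div, inv_pow, ← Real.rpow_natCast, ← Real.rpow_neg two_pos.le]
      exact Real.rpow_le_rpow_of_exponent_le one_le_two (by linarith)
  refine h1.trans ((prob_le_div_of_le_avg _ (fun ω => by positivity) (by positivity)).trans ?_)
  rw [avg_pow_card, two_rpow_eq_exp, div_le_iff₀ (Real.exp_pos _), ← Real.exp_add]
  have h2 : 1 + (1 / 2 - 1) * prob E ≤ Real.exp (-τ) := by
    have := Real.add_one_le_exp (-τ)
    linarith
  have h0 : 0 ≤ 1 + (1 / 2 - 1) * prob E := by have := prob_le_one E; linarith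
  refine (pow_le_pow_left₀ h0 h2 _).trans ?_
  rw [← Real.exp_nat_mul, Real.exp_le_exp]
  have := Real.log_two_lt_d9
  have hs : 0 ≤ τ * #s := by positivity
  nlinarith

end Average

/-! ### Random vertex sets -/

section RandomSet

/-- The space from which every vertex draws its coin. -/
abbrev Coin (J : ℕ) := Fin (2 ^ J) × Fin (2 ^ J)

variable {V W : Type} [Fintype V] [DecidableEq V] [Fintype W] [DecidableEq W] {J i j : ℕ}

/-- An event of probability `2 ^ (-j)` on one half of the coin. -/
def IsLow (j : ℕ) (x : Fin (2 ^ J)) : Prop := x.val < 2 ^ (J - j)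

/-- The vertices for which one of the two halves of the coin is low. -/
noncomputable def rset (j : ℕ) (f : W → Coin J) : Finset W :=
  {w | IsLow j (f w).1 ∨ IsLow j (f w).2}

/-- The probability that a given vertex belongs to the random set. -/
noncomputable def density (J j : ℕ) : ℝ := prob fun x : Coin J => IsLow j x.1 ∨ IsLow j x.2

/-- Some edge of `G` has both endpoints in `Q`. -/
def HasEdge {V : Type} (G : SimpleGraph V) (Q : Finset V) : Prop := ∃ u ∈ Q, ∃ v ∈ Q, G.Adj u v

/-- The probability that the random set at scale `j`, enlarged by `X`, contains an edge. -/
noncomputable def yesProb (G : SimpleGraph W) (J j : ℕ) (X : Finset W) : ℝ :=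
  prob fun f : W → Coin J => HasEdge G (rset j f ∪ X)

/-- The neighbours of a vertex. -/
noncomputable def nbrs (G : SimpleGraph W) (v : W) : Finset W := {u | G.Adj v u}

/-- The ordered pairs of adjacent vertices. -/
noncomputable def adjPairs (G : SimpleGraph W) : Finset (W × W) := {p | G.Adj p.1 p.2}

theorem IsLow.anti (h : i ≤ j) {x : Fin (2 ^ J)} (hx : IsLow j x) : IsLow i x :=
  lt_of_lt_of_le hx (Nat.pow_le_pow_right two_pos (by omega))

theorem rset_anti (h : i ≤ j) (f : W → Coin J) : rset j f ⊆ rset i f := by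
  intro w
  simp only [rset, mem_filter, mem_univ, true_and]
  exact Or.imp (IsLow.anti h) (IsLow.anti h)

theorem HasEdge.mono {G : SimpleGraph V} {Q R : Finset V} (h : Q ⊆ R) : HasEdge G Q → HasEdge G R :=
  fun ⟨u, hu, v, hv, huv⟩ => ⟨u, h hu, v, h hv, huv⟩

theorem prob_isLow (h : j ≤ J) : prob (fun x : Fin (2 ^ J) => IsLow j x) = (1 / 2) ^ j := by
  rw [prob, avg, sum_boole]
  have : #{x : Fin (2 ^ J) | IsLow j x} = 2 ^ (J - j) := by
    rw [← Fintype.card_subtype, Fintype.card_congr (β := Fin (2 ^ (J - j)))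
      ⟨fun x => ⟨x.1.1, x.2⟩, fun y => ⟨⟨y.1, y.2.trans_le
        (Nat.pow_le_pow_right two_pos (Nat.sub_le J j))⟩, y.2⟩, fun _ => rfl, fun _ => rfl⟩,
      Fintype.card_fin]
  rw [this, Fintype.card_fin]
  push_cast
  rw [pow_sub₀ _ two_ne_zero h]
  field_simp
  simp

theorem half_pow_le_density (h : j ≤ J) : (1 / 2) ^ j ≤ density J j := by
  rw [← prob_isLow h, density]
  exact (prob_fst _).symm.trans_le (prob_mono fun x hx => Or.inl hx)

theorem density_le (h : j ≤ J) : density J j ≤ 2 * (1 / 2) ^ j := by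
  have h1 : prob (fun x : Coin J => IsLow j x.1) = (1 / 2) ^ j :=
    (prob_fst _).trans (prob_isLow h)
  have h2 : prob (fun x : Coin J => IsLow j x.2) = (1 / 2) ^ j :=
    (prob_snd _).trans (prob_isLow h)
  have := prob_or_le (fun x : Coin J => IsLow j x.1) (fun x : Coin J => IsLow j x.2)
  rw [density]; linarith

theorem density_anti (h : i ≤ j) : density J j ≤ density J i :=
  prob_mono fun _ => Or.imp (IsLow.anti h) (IsLow.anti h)

theorem density_nonneg : 0 ≤ density J j := prob_nonneg _

/-- The coin of `u` is independent of the rest, so conditioning on membership of `u` amounts to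
inserting `u` by hand. -/
theorem prob_mem_and (j : ℕ) (u : W) (Φ : Finset W → Prop) :
    prob (fun f : W → Coin J => u ∈ rset j f ∧ Φ (rset j f))
      = density J j * prob (fun f : W → Coin J => Φ (insert u (rset j f))) := by
  conv_lhs => rw [prob, avg_update u]
  rw [prob, ← avg_mul_left]
  congr 1; ext f
  rw [density, prob, mul_comm, ← avg_mul_left]
  congr 1; ext x
  by_cases hx : IsLow j x.1 ∨ IsLow j x.2
  · have h1 : rset j (Function.update f u x) = insert u (rset j f) := by
      ext w
      by_cases hw : w = u
      · subst hw; simp [rset, hx]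
      · simp [rset, hw]
    simp [h1, hx]
  · have h1 : u ∉ rset j (Function.update f u x) := by simpa [rset] using hx
    simp [h1, hx]

theorem prob_mem (j : ℕ) (u : W) : prob (fun f : W → Coin J => u ∈ rset j f) = density J j := by
  have := prob_mem_and (J := J) j u fun _ => True
  rwa [prob_true, mul_one, prob_congr fun x => Iff.of_eq (and_true _)] at this

theorem prob_mem_mem (j : ℕ) {u v : W} (h : u ≠ v) :
    prob (fun f : W → Coin J => u ∈ rset j f ∧ v ∈ rset j f) = density J j ^ 2 := by
  rw [prob_mem_and j u fun S => v ∈ S, prob_congr fun f => mem_insert.trans (or_iff_right h.symm),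
    prob_mem, sq]

variable (G : SimpleGraph W)

/-- Each of the two vertices is paid for with one factor of density; what remains is that the set
enlarged by both is edgeless. This bounds from below the chance that one random query certifies the
pair. -/
theorem prob_mem_mem_not_hasEdge (j : ℕ) (u v : W) :
    prob (fun f : W → Coin J => u ∈ rset j f ∧ v ∈ rset j f ∧ ¬ HasEdge G (rset j f))
      ≥ density J j ^ 2 * (1 - yesProb G J j {u, v}) := by
  rw [prob_mem_and j u fun S => v ∈ S ∧ ¬ HasEdge G S, sq, mul_assoc, yesProb, ← prob_not]
  refine mul_le_mul_of_nonneg_left ?_ density_nonneg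
  -- A redundant `insert v` creates the shape in which `prob_mem_and` applies to `v`.
  have e : prob (fun f : W → Coin J => ¬ HasEdge G (rset j f ∪ {u, v}))
      = prob (fun f : W → Coin J => ¬ HasEdge G (insert v (rset j f) ∪ {u, v})) :=
    prob_congr fun f => by rw [insert_union, insert_eq_of_mem (a := v) (s := rset j f ∪ {u, v}) (by simp)]
  rw [e, ← prob_mem_and j v fun S => ¬ HasEdge G (S ∪ {u, v})]
  refine prob_mono fun f ⟨h1, h2⟩ => ⟨mem_insert_of_mem h1, fun h => h2 (h.mono ?_)⟩
  intro w; simp only [mem_insert, mem_union, mem_singleton]; tauto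

theorem prob_mem_not_hasEdge_insert (j : ℕ) (h v : W) :
    prob (fun f : W → Coin J => v ∈ rset j f ∧ ¬ HasEdge G (rset j f ∪ {h}))
      ≥ density J j * (1 - yesProb G J j {h, v}) := by
  rw [prob_mem_and j v fun S => ¬ HasEdge G (S ∪ {h}), yesProb, ← prob_not]
  refine mul_le_mul_of_nonneg_left (prob_mono fun f h2 h1 => h2 (h1.mono ?_)) density_nonneg
  intro w; simp only [mem_insert, mem_union, mem_singleton]; tauto

theorem yesProb_anti (h : i ≤ j) (X : Finset W) : yesProb G J j X ≤ yesProb G J i X :=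
  prob_mono fun f => HasEdge.mono (union_subset_union_left (rset_anti h f))

/-- An edge that appears only through adding `v` ends at `v`, and by `hX` its other end is a
neighbour that was drawn at random; a union bound over the neighbours follows. -/
theorem yesProb_insert_le (X : Finset W) (v : W) (hX : ∀ u ∈ X, ¬ G.Adj v u) :
    yesProb G J j (insert v X) ≤ yesProb G J j X + density J j * #(nbrs G v) := by
  have h1 : yesProb G J j (insert v X) ≤ prob (fun f : W → Coin J =>
      HasEdge G (rset j f ∪ X) ∨ ∃ u ∈ nbrs G v, u ∈ rset j f) := by
    refine prob_mono fun f ⟨a, ha, b, hb, hab⟩ => ?_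
    by_contra hcon
    push Not at hcon
    obtain ⟨h1, h2⟩ := hcon
    have hv : ∀ c ∈ rset j f ∪ insert v X, ¬ G.Adj v c := by
      intro c hc hvc
      simp only [mem_union, mem_insert] at hc
      rcases hc with hc | rfl | hc
      · exact h2 c (by simp [nbrs, hvc]) hc
      · exact G.loopless.irrefl _ hvc
      · exact hX c hc hvc
    have hmem : ∀ c ∈ rset j f ∪ insert v X, c ≠ v → c ∈ rset j f ∪ X := by
      intro c hc hcv
      simp only [mem_union, mem_insert, hcv, false_or] at hc ⊢
      exact hc
    refine h1 ⟨a, hmem a ha ?_, b, hmem b hb ?_, hab⟩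
    · rintro rfl; exact hv b hb hab
    · rintro rfl; exact hv a ha hab.symm
  refine h1.trans ((prob_or_le _ _).trans (add_le_add_right ?_ _))
  refine (prob_exists_le_card_mul _ _ (density J j) fun u _ => (prob_mem j u).le).trans_eq ?_
  ring

theorem yesProb_empty_le : yesProb G J j ∅ ≤ density J j ^ 2 * #(adjPairs G) := by
  have h1 : yesProb G J j ∅ ≤ prob (fun f : W → Coin J =>
      ∃ p ∈ adjPairs G, p.1 ∈ rset j f ∧ p.2 ∈ rset j f) := by
    refine prob_mono fun f ⟨a, ha, b, hb, hab⟩ => ⟨(a, b), by simp [adjPairs, hab], ?_, ?_⟩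
    · simpa using ha
    · simpa using hb
  refine h1.trans ((prob_exists_le_card_mul _ _ (density J j ^ 2) fun p hp => ?_).trans_eq
    (mul_comm _ _))
  refine (prob_mem_mem j fun h => ?_).le
  simp only [adjPairs, mem_filter, mem_univ, true_and, h] at hp
  exact G.loopless.irrefl _ hp

/-- Bernoulli's inequality combined with `(1 - p)(1 + p) ≤ 1`. It yields rational upper bounds for
`(1 - p) ^ k`. -/
theorem one_sub_pow_mul_le {p : ℝ} (h0 : 0 ≤ p) (h1 : p ≤ 1) (k : ℕ) :
    (1 - p) ^ k * (1 + k * p) ≤ 1 := by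
  have h2 : 1 + k * p ≤ (1 + p) ^ k := one_add_mul_le_pow (by linarith) k
  calc (1 - p) ^ k * (1 + k * p) ≤ (1 - p) ^ k * (1 + p) ^ k :=
        mul_le_mul_of_nonneg_left h2 (pow_nonneg (by linarith) _)
    _ = (1 - p ^ 2) ^ k := by rw [← mul_pow]; ring
    _ ≤ 1 := pow_le_one₀ (by nlinarith) (by nlinarith)

theorem prob_exists_isLow (h : j ≤ J) (X : Finset W) :
    prob (fun f : W → Fin (2 ^ J) => ∃ u ∈ X, IsLow j (f u)) = 1 - (1 - (1 / 2) ^ j) ^ #X := by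
  rw [← prob_isLow h, ← prob_forall_not, ← prob_not]
  exact prob_congr fun f => by push Not; rfl

/-- Many vertices of large degree force an edge into the random set. -/
theorem le_yesProb_empty (h : j ≤ J) (X : Finset W) (d : ℕ) (hX : ∀ v ∈ X, d ≤ #(nbrs G v)) :
    (1 - (1 - (1 / 2) ^ j) ^ #X) * (1 - (1 - (1 / 2) ^ j) ^ d) ≤ yesProb G J j ∅ := by
  -- This is why a coin has two halves: they form independent families, so the first can pick a
  -- vertex of `X` and the second one of its neighbours, with no correlations to control.
  have e : yesProb G J j ∅ = prob (fun p : (W → Fin (2 ^ J)) × (W → Fin (2 ^ J)) =>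
      HasEdge G (rset j fun w => (p.1 w, p.2 w))) := by
    rw [prob, ← avg_equiv (Equiv.arrowProdEquivProdArrow W _ _), yesProb, prob]
    simp [Equiv.arrowProdEquivProdArrow]
  have hp0 : (0 : ℝ) ≤ 1 - (1 / 2) ^ j := sub_nonneg.2 (pow_le_one₀ (by norm_num) (by norm_num))
  have hp1 : (1 : ℝ) - (1 / 2) ^ j ≤ 1 := sub_le_self _ (by positivity)
  rw [e, ← prob_exists_isLow h, mul_comm, prob, prob, ← avg_mul_left, avg_prod]
  refine avg_mono fun f => ?_
  split_ifs with hf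
  · obtain ⟨u, hu, hlow⟩ := hf
    rw [mul_one]
    calc 1 - (1 - (1 / 2) ^ j) ^ d ≤ 1 - (1 - (1 / 2) ^ j) ^ #(nbrs G u) :=
          sub_le_sub_left (pow_le_pow_of_le_one hp0 hp1 (hX u hu)) _
      _ = prob (fun f : W → Fin (2 ^ J) => ∃ v ∈ nbrs G u, IsLow j (f v)) :=
          (prob_exists_isLow h _).symm
      _ ≤ _ := prob_mono fun f' ⟨v, hv, hlow'⟩ => ⟨u, by simp [rset, hlow], v, by simp [rset, hlow'],
          by simpa [nbrs] using hv⟩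
  · rw [mul_zero]
    exact avg_nonneg fun _ => by split_ifs <;> norm_num

theorem sum_card_nbrs_le (X : Finset W) : ∑ v ∈ X, #(nbrs G v) ≤ #(adjPairs G) := by
  rw [← card_sigma]
  refine card_le_card_of_injOn (fun p => (p.1, p.2)) ?_ ?_
  · rintro ⟨a, b⟩ h
    simp only [coe_sigma, Set.mem_sigma_iff, mem_coe, nbrs, mem_filter, mem_univ, true_and] at h
    simpa [adjPairs] using h.2
  · rintro ⟨a, b⟩ _ ⟨c, d⟩ _ h
    simpa using h

end RandomSet

/-! ### Independent trials and their typical behaviour -/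

section Trials

variable {W : Type} [Fintype W] [DecidableEq W] {J r : ℕ}

/-- Independent trials of the coins of all vertices. -/
abbrev Trials (W : Type) (J r : ℕ) := Fin (4 ^ J * r) → W → Coin J

/-- The first `k` trials. -/
noncomputable def first (J r k : ℕ) : Finset (Fin (4 ^ J * r)) := {t | t.val < k}

/-- The number of the first `r` random sets at scale `j` which contain an edge after adding `X`. -/
noncomputable def yesCount (G : SimpleGraph W) (ω : Trials W J r) (j : ℕ) (X : Finset W) : ℕ :=
  #{t ∈ first J r r | HasEdge G (rset j (ω t) ∪ X)}

/-- The two thresholds of the tests. -/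
noncomputable def thresholds : Finset ℝ := {1 / 32, 1 / 4}

/-- The trials are typical for `G`: all tests are accurate, and all pairs that are likely to be
separated from the edges are. -/
structure Typical (G : SimpleGraph W) (ω : Trials W J r) : Prop where
  pass : ∀ j < J, ∀ o : Option W, ∀ τ ∈ thresholds,
    (yesCount G ω j o.toFinset : ℝ) ≤ τ * r → yesProb G J j o.toFinset < 2 * τ
  fail : ∀ j < J, ∀ o : Option W, ∀ τ ∈ thresholds,
    τ * r < (yesCount G ω j o.toFinset : ℝ) → τ / 2 < yesProb G J j o.toFinset
  -- A trial succeeds with probability at least `4^-j / 4`, so `4 ^ j * r` trials give about `r / 4`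
  -- expected successes; with one vertex forced in, `2 ^ j * r` trials do.
  pair : ∀ j < J, ∀ u v : W, yesProb G J j {u, v} ≤ 3 / 4 →
    ∃ t ∈ first J r (4 ^ j * r), u ∈ rset j (ω t) ∧ v ∈ rset j (ω t) ∧ ¬ HasEdge G (rset j (ω t))
  single : ∀ j < J, ∀ h v : W, yesProb G J j {h, v} ≤ 3 / 4 →
    ∃ t ∈ first J r (2 ^ j * r), v ∈ rset j (ω t) ∧ ¬ HasEdge G (rset j (ω t) ∪ {h})

theorem card_first {k : ℕ} (h : k ≤ 4 ^ J * r) : #(first J r k) = k := by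
  rw [first, Fin.card_filter_val_lt, min_eq_right h]

theorem card_first_le (k : ℕ) : #(first J r k) ≤ k := by
  rw [first, Fin.card_filter_val_lt]; exact min_le_right _ _

theorem card_first_self : #(first J r r) = r :=
  card_first (Nat.le_mul_of_pos_left _ (by positivity))

theorem card_first_two {j : ℕ} (h : j < J) : #(first J r (2 ^ j * r)) = 2 ^ j * r :=
  card_first (Nat.mul_le_mul_right _ ((Nat.pow_le_pow_left (by norm_num) j).trans
    (Nat.pow_le_pow_right (by norm_num) h.le)))

theorem card_first_four {j : ℕ} (h : j < J) : #(first J r (4 ^ j * r)) = 4 ^ j * r :=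
  card_first (Nat.mul_le_mul_right _ (Nat.pow_le_pow_right (by norm_num) h.le))

/-- The natural exponent `r / 4` is weakened to `r / 200`, so that all four clauses of `Typical`
share one error bound. -/
theorem prob_forall_not_le (s : Finset (Fin (4 ^ J * r))) (E : (W → Coin J) → Prop)
    (h : (r : ℝ) / 4 ≤ #s * prob E) :
    prob (fun ω : Trials W J r => ∀ t ∈ s, ¬ E (ω t)) ≤ Real.exp (-(r / 200)) := by
  rw [prob_forall_not]
  have h1 : 1 - prob E ≤ Real.exp (-prob E) := by
    have := Real.add_one_le_exp (-prob E); linarith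
  refine (pow_le_pow_left₀ (sub_nonneg.2 (prob_le_one E)) h1 _).trans ?_
  rw [← Real.exp_nat_mul, Real.exp_le_exp]
  have : (0 : ℝ) ≤ r := Nat.cast_nonneg r
  linarith

variable (G : SimpleGraph W)

/-- The smaller threshold `1/32` turns the tail exponent `τ r / 6` into `r / 192`, whence the rate
`r / 200`. -/
theorem prob_not_pass_le {j : ℕ} (X : Finset W) {τ : ℝ} (hτ : τ ∈ thresholds) :
    prob (fun ω : Trials W J r => ¬ ((yesCount G ω j X : ℝ) ≤ τ * r → yesProb G J j X < 2 * τ))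
      ≤ Real.exp (-(r / 200)) := by
  have hr : (0 : ℝ) ≤ r := Nat.cast_nonneg r
  have hτ' : 1 / 32 ≤ τ := by
    simp only [thresholds, mem_insert, mem_singleton] at hτ
    rcases hτ with rfl | rfl <;> norm_num
  by_cases h : yesProb G J j X < 2 * τ
  · simp only [h, implies_true, not_true]
    simp only [prob, if_false]
    rw [avg_const]; positivity
  · have h1 := prob_count_le_le (first J r r) (fun f : W → Coin J => HasEdge G (rset j f ∪ X))
      (by linarith : 0 ≤ τ) (not_lt.1 h)
    rw [card_first_self] at h1
    refine (prob_mono fun ω hω => ?_).trans (h1.trans (Real.exp_le_exp.2 (by nlinarith)))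
    exact (Classical.not_imp.1 hω).1

theorem prob_not_fail_le {j : ℕ} (X : Finset W) {τ : ℝ} (hτ : τ ∈ thresholds) :
    prob (fun ω : Trials W J r => ¬ (τ * r < (yesCount G ω j X : ℝ) → τ / 2 < yesProb G J j X))
      ≤ Real.exp (-(r / 200)) := by
  have hr : (0 : ℝ) ≤ r := Nat.cast_nonneg r
  have hτ' : 1 / 32 ≤ τ := by
    simp only [thresholds, mem_insert, mem_singleton] at hτ
    rcases hτ with rfl | rfl <;> norm_num
  by_cases h : τ / 2 < yesProb G J j X
  · simp only [h, implies_true, not_true]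
    simp only [prob, if_false]
    rw [avg_const]; positivity
  · have h1 := prob_count_gt_le (first J r r) (fun f : W → Coin J => HasEdge G (rset j f ∪ X))
      (by linarith : 0 ≤ τ) (not_lt.1 h)
    rw [card_first_self] at h1
    refine (prob_mono fun ω hω => ?_).trans (h1.trans (Real.exp_le_exp.2 (by nlinarith)))
    exact (Classical.not_imp.1 hω).1

theorem prob_not_pair_le {j : ℕ} (hj : j < J) (u v : W) :
    prob (fun ω : Trials W J r => ¬ (yesProb G J j {u, v} ≤ 3 / 4 → ∃ t ∈ first J r (4 ^ j * r),
      u ∈ rset j (ω t) ∧ v ∈ rset j (ω t) ∧ ¬ HasEdge G (rset j (ω t)))) ≤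
      Real.exp (-(r / 200)) := by
  by_cases h : yesProb G J j {u, v} ≤ 3 / 4
  · refine (prob_mono fun ω hω => ?_).trans (prob_forall_not_le (first J r (4 ^ j * r))
      (fun f : W → Coin J => u ∈ rset j f ∧ v ∈ rset j f ∧ ¬ HasEdge G (rset j f)) ?_)
    · intro t ht hE
      exact hω fun _ => ⟨t, ht, hE⟩
    · rw [card_first_four hj]
      have h1 := prob_mem_mem_not_hasEdge (J := J) G j u v
      have h2 : (1 / 4 : ℝ) ^ j ≤ density J j ^ 2 := by
        calc (1 / 4 : ℝ) ^ j = ((1 / 2) ^ j) ^ 2 := by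
              rw [← pow_mul, mul_comm, pow_mul]; norm_num
          _ ≤ _ := pow_le_pow_left₀ (by positivity) (half_pow_le_density hj.le) 2
      have h3 : (1 / 4 : ℝ) ^ j * (1 / 4) ≤ density J j ^ 2 * (1 - yesProb G J j {u, v}) :=
        mul_le_mul h2 (by linarith) (by norm_num) (by positivity)
      have h4 : (r : ℝ) / 4 = (4 ^ j * r : ℕ) * ((1 / 4 : ℝ) ^ j * (1 / 4)) := by
        push_cast; rw [one_div, inv_pow]; field_simp
      rw [h4]
      exact mul_le_mul_of_nonneg_left (h3.trans h1) (Nat.cast_nonneg _)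
  · simp only [h, false_imp_iff, not_true]
    simp only [prob, if_false]
    rw [avg_const]; positivity

theorem prob_not_single_le {j : ℕ} (hj : j < J) (h v : W) :
    prob (fun ω : Trials W J r => ¬ (yesProb G J j {h, v} ≤ 3 / 4 → ∃ t ∈ first J r (2 ^ j * r),
      v ∈ rset j (ω t) ∧ ¬ HasEdge G (rset j (ω t) ∪ {h}))) ≤ Real.exp (-(r / 200)) := by
  by_cases hy : yesProb G J j {h, v} ≤ 3 / 4
  · refine (prob_mono fun ω hω => ?_).trans (prob_forall_not_le (first J r (2 ^ j * r))
      (fun f : W → Coin J => v ∈ rset j f ∧ ¬ HasEdge G (rset j f ∪ {h})) ?_)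
    · intro t ht hE
      exact hω fun _ => ⟨t, ht, hE⟩
    · rw [card_first_two hj]
      have h1 := prob_mem_not_hasEdge_insert (J := J) G j h v
      have h3 : (1 / 2 : ℝ) ^ j * (1 / 4) ≤ density J j * (1 - yesProb G J j {h, v}) :=
        mul_le_mul (half_pow_le_density hj.le) (by linarith) (by norm_num) density_nonneg
      have h4 : (r : ℝ) / 4 = (2 ^ j * r : ℕ) * ((1 / 2 : ℝ) ^ j * (1 / 4)) := by
        push_cast; rw [one_div, inv_pow]; field_simp
      rw [h4]
      exact mul_le_mul_of_nonneg_left (h3.trans h1) (Nat.cast_nonneg _)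
  · simp only [hy, false_imp_iff, not_true]
    simp only [prob, if_false]
    rw [avg_const]; positivity

/-- The union bound runs over all scales, vertices and pairs, regardless of what the learner
selects. Hence adaptive rounds may reuse the same trials. With `N` vertices there are at most `4J(N
+ 1)` test events and `2JN²` pair events. -/
theorem prob_not_typical_le [Nonempty W] :
    prob (fun ω : Trials W J r => ¬ Typical G ω)
      ≤ 10 * J * Fintype.card W ^ 2 * Real.exp (-(r / 200)) := by
  set ε := Real.exp (-((r : ℝ) / 200)) with hε
  have hε0 : 0 ≤ ε := (Real.exp_pos _).le
  set S : Finset (ℕ × Option W × ℝ) := range J ×ˢ univ ×ˢ thresholds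
  set P : Finset (ℕ × W × W) := range J ×ˢ univ ×ˢ univ
  have hS : (#S : ℝ) ≤ J * ((Fintype.card W + 1) * 2) := by
    have h2 : #thresholds ≤ 2 := card_le_two
    have : #S ≤ J * ((Fintype.card W + 1) * 2) := by
      simp only [S, card_product, card_range, card_univ, Fintype.card_option]
      exact Nat.mul_le_mul_left _ (Nat.mul_le_mul_left _ h2)
    exact_mod_cast this
  have hP : (#P : ℝ) = J * (Fintype.card W * Fintype.card W) := by
    simp only [P, card_product, card_range, card_univ]; push_cast; ring
  have h1 := prob_exists_le_card_mul S (fun i (ω : Trials W J r) =>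
    ¬ ((yesCount G ω i.1 i.2.1.toFinset : ℝ) ≤ i.2.2 * r → yesProb G J i.1 i.2.1.toFinset
      < 2 * i.2.2)) ε fun i hi => by
        simp only [S, mem_product] at hi
        exact prob_not_pass_le G _ hi.2.2
  have h2 := prob_exists_le_card_mul S (fun i (ω : Trials W J r) =>
    ¬ (i.2.2 * r < (yesCount G ω i.1 i.2.1.toFinset : ℝ) → i.2.2 / 2
      < yesProb G J i.1 i.2.1.toFinset)) ε fun i hi => by
        simp only [S, mem_product] at hi
        exact prob_not_fail_le G _ hi.2.2
  have h3 := prob_exists_le_card_mul P (fun i (ω : Trials W J r) =>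
    ¬ (yesProb G J i.1 {i.2.1, i.2.2} ≤ 3 / 4 → ∃ t ∈ first J r (4 ^ i.1 * r),
      i.2.1 ∈ rset i.1 (ω t) ∧ i.2.2 ∈ rset i.1 (ω t) ∧ ¬ HasEdge G (rset i.1 (ω t)))) ε
      fun i hi => by
        simp only [P, mem_product, mem_range] at hi
        exact prob_not_pair_le G hi.1 _ _
  have h4 := prob_exists_le_card_mul P (fun i (ω : Trials W J r) =>
    ¬ (yesProb G J i.1 {i.2.1, i.2.2} ≤ 3 / 4 → ∃ t ∈ first J r (2 ^ i.1 * r),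
      i.2.2 ∈ rset i.1 (ω t) ∧ ¬ HasEdge G (rset i.1 (ω t) ∪ {i.2.1}))) ε
      fun i hi => by
        simp only [P, mem_product, mem_range] at hi
        exact prob_not_single_le G hi.1 _ _
  have hall : prob (fun ω : Trials W J r => ¬ Typical G ω) ≤ #S * ε + (#S * ε + (#P * ε + #P * ε)) := by
    refine le_trans ?_ (add_le_add h1 (add_le_add h2 (add_le_add h3 h4)))
    refine le_trans (prob_mono fun ω hω => ?_) ((prob_or_le _ _).trans (add_le_add_right
      ((prob_or_le _ _).trans (add_le_add_right (prob_or_le _ _) _)) _))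
    by_contra hcon
    push Not at hcon
    obtain ⟨c1, c2, c3, c4⟩ := hcon
    exact hω ⟨fun j hj o τ hτ => c1 (j, o, τ) (by simp [S, hj, hτ]),
      fun j hj o τ hτ => c2 (j, o, τ) (by simp [S, hj, hτ]),
      fun j hj u v => c3 (j, u, v) (by simp [P, hj]), fun j hj u v => c4 (j, u, v) (by simp [P, hj])⟩
  refine hall.trans ?_
  have hN : (1 : ℝ) ≤ Fintype.card W := by exact_mod_cast Fintype.card_pos
  have hJ : (0 : ℝ) ≤ J := Nat.cast_nonneg J
  have h5 : (#S : ℝ) + (#S + (#P + #P)) ≤ 10 * J * Fintype.card W ^ 2 := by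
    rw [hP]; nlinarith [mul_nonneg hJ (sub_nonneg.2 hN),
      mul_nonneg hJ (mul_nonneg (sub_nonneg.2 hN) (sub_nonneg.2 hN))]
  calc _ = ((#S : ℝ) + (#S + (#P + #P))) * ε := by ring
    _ ≤ _ := mul_le_mul_of_nonneg_right h5 hε0

end Trials

/-! ### The four rounds of the group testing strategy -/

section Core

variable {W : Type} [Fintype W] [DecidableEq W] {J r : ℕ}

/-- Some query of `K` contains both `u` and `v`. -/
def Certified (K : Set (Finset W)) (u v : W) : Prop := ∃ Q ∈ K, u ∈ Q ∧ v ∈ Q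

/-- The ordered pairs of distinct vertices not covered by a query of `K`. -/
noncomputable def uncert (K : Set (Finset W)) : Finset (W × W) :=
  {p | p.1 ≠ p.2 ∧ ¬ Certified K p.1 p.2}

/-- The possible neighbours of `v` when exactly the queries of `K` are known to be edgeless. -/
noncomputable def cand (K : Set (Finset W)) (v : W) : Finset W := {u | v ≠ u ∧ ¬ Certified K v u}

/-- The least scale `j ≥ lo` with `P j`, or the first one from `J` on if there is none below `J`. -/
noncomputable def leastScale (P : ℕ → Prop) (lo J : ℕ) : ℕ := sInf {j | lo ≤ j ∧ (P j ∨ J ≤ j)}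

/-- The number of the first `r` random sets at scale `j` which, enlarged by `X`, are not in `K`. -/
noncomputable def testCount (ω : Trials W J r) (K : Set (Finset W)) (j : ℕ) (X : Finset W) : ℕ :=
  #{t ∈ first J r r | rset j (ω t) ∪ X ∉ K}

/-- The main scale, estimated from the known edgeless queries. -/
noncomputable def scale (ω : Trials W J r) (K : Set (Finset W)) : ℕ :=
  leastScale (fun j => 32 * testCount ω K j ∅ ≤ r) 0 J

/-- The scale of the vertex `h`, estimated from the known edgeless queries. -/
noncomputable def scaleOf (ω : Trials W J r) (K : Set (Finset W)) (h : W) : ℕ :=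
  leastScale (fun j => 4 * testCount ω K j {h} ≤ r) (scale ω K) J

/-- The vertices with many possible neighbours. -/
noncomputable def heavy (ω : Trials W J r) (K : Set (Finset W)) : Finset W :=
  {v | 3 * 2 ^ scale ω K < #(cand K v)}

/-- The estimates are plausible, so that it is worth going on. -/
def Plausible (ω : Trials W J r) (K : Set (Finset W)) : Prop :=
  scale ω K < J ∧ #(heavy ω K) ≤ 2 * 2 ^ scale ω K

/-- First round: random sets at all scales. -/
noncomputable def round1 (ω : Trials W J r) : Finset (Finset W) :=
  (range J ×ˢ first J r r).image fun p => rset p.1 (ω p.2)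

/-- Second round: many random sets at the main scale. -/
noncomputable def round2 (ω : Trials W J r) (K : Set (Finset W)) : Finset (Finset W) :=
  if scale ω K < J then (first J r (4 ^ scale ω K * r)).image fun t => rset (scale ω K) (ω t) else ∅

/-- Third round: random sets at all scales together with one heavy vertex. -/
noncomputable def round3 (ω : Trials W J r) (K : Set (Finset W)) : Finset (Finset W) :=
  if Plausible ω K then
    (heavy ω K ×ˢ range J ×ˢ first J r r).image fun p => rset p.2.1 (ω p.2.2) ∪ {p.1}
  else ∅

/-- Fourth round: for every heavy vertex, many random sets at its scale together with it. -/
noncomputable def round4 (ω : Trials W J r) (K : Set (Finset W)) : Finset (Finset W) :=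
  if Plausible ω K then
    (heavy ω K).biUnion fun h =>
      if scaleOf ω K h < J then
        (first J r (2 ^ scaleOf ω K h * r)).image fun t => rset (scaleOf ω K h) (ω t) ∪ {h}
      else ∅
  else ∅

/-- The alternative `J ≤ j` keeps the set nonempty, so the infimum is attained; a value of at least
`J` signals that no scale was found. -/
theorem leastScale_spec (P : ℕ → Prop) (lo J : ℕ) :
    lo ≤ leastScale P lo J ∧ (P (leastScale P lo J) ∨ J ≤ leastScale P lo J) :=
  Nat.sInf_mem (s := {j | lo ≤ j ∧ (P j ∨ J ≤ j)}) ⟨max lo J, le_max_left _ _, Or.inr (le_max_right _ _)⟩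

theorem not_of_lt_leastScale {P : ℕ → Prop} {lo J j : ℕ} (h1 : lo ≤ j) (h2 : j < leastScale P lo J) :
    ¬ P j ∧ j < J := by
  have := Nat.notMem_of_lt_sInf h2
  simp only [Set.mem_ofPred_eq, not_and, not_or, not_le] at this
  exact this h1

theorem leastScale_congr {P Q : ℕ → Prop} (lo J : ℕ) (h : ∀ j < J, (P j ↔ Q j)) :
    leastScale P lo J = leastScale Q lo J := by
  unfold leastScale
  congr 1; ext j
  simp only [Set.mem_ofPred_eq]
  rcases lt_or_ge j J with hj | hj
  · rw [h j hj]
  · simp [hj]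

theorem Certified.mono {K K' : Set (Finset W)} (h : K ⊆ K') {u v : W} :
    Certified K u v → Certified K' u v :=
  fun ⟨Q, hQ, hu⟩ => ⟨Q, h hQ, hu⟩

theorem Certified.symm {K : Set (Finset W)} {u v : W} : Certified K u v → Certified K v u :=
  fun ⟨Q, hQ, hu, hv⟩ => ⟨Q, hQ, hv, hu⟩

theorem cand_anti {K K' : Set (Finset W)} (h : K ⊆ K') (v : W) : cand K' v ⊆ cand K v := by
  intro u
  simp only [cand, mem_filter, mem_univ, true_and]
  exact fun hu => ⟨hu.1, fun hc => hu.2 (hc.mono h)⟩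

theorem uncert_anti {K K' : Set (Finset W)} (h : K ⊆ K') : uncert K' ⊆ uncert K := by
  intro p
  simp only [uncert, mem_filter, mem_univ, true_and]
  exact fun hu => ⟨hu.1, fun hc => hu.2 (hc.mono h)⟩

/-! ### Costs of the rounds in the worst case -/

theorem card_round1_le (ω : Trials W J r) : #(round1 ω) ≤ J * r := by
  refine card_image_le.trans ?_
  rw [card_product, card_range, card_first_self]

theorem card_round2_le (ω : Trials W J r) (K : Set (Finset W)) :
    #(round2 ω K) ≤ if scale ω K < J then 4 ^ scale ω K * r else 0 := by
  unfold round2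
  split_ifs
  · exact card_image_le.trans (card_first_le _)
  · simp

theorem card_round3_le (ω : Trials W J r) (K : Set (Finset W)) :
    #(round3 ω K) ≤ if scale ω K < J then 2 * 2 ^ scale ω K * (J * r) else 0 := by
  unfold round3
  split_ifs with h1 h2 h2
  · refine card_image_le.trans ?_
    rw [card_product, card_product, card_range, card_first_self]
    exact Nat.mul_le_mul_right _ h1.2
  · exact absurd h1.1 h2
  · simp
  · simp

theorem card_round4_le (ω : Trials W J r) (K : Set (Finset W)) :
    #(round4 ω K) ≤ if Plausible ω K then
      ∑ h ∈ heavy ω K, if scaleOf ω K h < J then 2 ^ scaleOf ω K h * r else 0 else 0 := by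
  unfold round4
  split_ifs with h1
  · refine card_biUnion_le.trans (sum_le_sum fun h _ => ?_)
    split_ifs
    · exact card_image_le.trans (card_first_le _)
    · simp
  · simp

/-- No typicality is needed, because the rounds themselves refuse to act at scales from `J` on or
with too many heavy vertices. This prices the rare bad events. -/
theorem card_rounds_le_worst (ω : Trials W J r) (K₂ K₃ K₄ : Set (Finset W)) :
    #(round1 ω) + #(round2 ω K₂) + #(round3 ω K₃) + #(round4 ω K₄) ≤ 6 * 4 ^ J * ((J + 1) * r) := by
  have h1 := card_round1_le ω
  have h2 : #(round2 ω K₂) ≤ 4 ^ J * r := by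
    refine (card_round2_le ω K₂).trans ?_
    split_ifs with h
    · exact Nat.mul_le_mul_right _ (Nat.pow_le_pow_right (by norm_num) h.le)
    · exact Nat.zero_le _
  have h3 : #(round3 ω K₃) ≤ 2 * 2 ^ J * (J * r) := by
    refine (card_round3_le ω K₃).trans ?_
    split_ifs with h
    · exact Nat.mul_le_mul_right _ (Nat.mul_le_mul_left _ (Nat.pow_le_pow_right (by norm_num) h.le))
    · exact Nat.zero_le _
  have h4 : #(round4 ω K₄) ≤ 2 * 2 ^ J * (2 ^ J * r) := by
    refine (card_round4_le ω K₄).trans ?_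
    split_ifs with h
    · refine (sum_le_card_nsmul _ _ (2 ^ J * r) fun v _ => ?_).trans ?_
      · split_ifs with h'
        · exact Nat.mul_le_mul_right _ (Nat.pow_le_pow_right (by norm_num) h'.le)
        · exact Nat.zero_le _
      · rw [smul_eq_mul]
        exact Nat.mul_le_mul_right _ (h.2.trans (Nat.mul_le_mul_left _
          (Nat.pow_le_pow_right (by norm_num) h.1.le)))
    · exact Nat.zero_le _
  have e : (4 : ℕ) ^ J = 2 ^ J * 2 ^ J := (mul_pow 2 2 J)
  have h5 : 1 ≤ 2 ^ J := Nat.one_le_two_pow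
  have h6 : 2 ^ J ≤ 4 ^ J := Nat.pow_le_pow_left (by norm_num) J
  have h7 : 2 ^ J * (J * r) ≤ 4 ^ J * (J * r) := Nat.mul_le_mul_right _ h6
  have h8 : 1 * (J * r) ≤ 4 ^ J * (J * r) := Nat.mul_le_mul_right _ (h5.trans h6)
  have h9 : 2 * 2 ^ J * (2 ^ J * r) = 2 * (4 ^ J * r) := by rw [e]; ring
  have h10 : 6 * 4 ^ J * ((J + 1) * r) = 6 * (4 ^ J * (J * r)) + 6 * (4 ^ J * r) := by ring
  rw [h9] at h4
  rw [h10]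
  linarith

/-! ### Behaviour for typical trials -/

/-- All queries of `K` are edgeless. -/
def Sound (G : SimpleGraph W) (K : Set (Finset W)) : Prop := ∀ Q ∈ K, ¬ HasEdge G Q

/-- All edgeless queries of `R` are in `K`. -/
def Complete (G : SimpleGraph W) (R : Finset (Finset W)) (K : Set (Finset W)) : Prop :=
  ∀ Q ∈ R, ¬ HasEdge G Q → Q ∈ K

theorem Complete.mono {G : SimpleGraph W} {R : Finset (Finset W)} {K K' : Set (Finset W)}
    (h : Complete G R K) (hK : K ⊆ K') : Complete G R K' :=
  fun Q hQ hG => hK (h Q hQ hG)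

variable (G : SimpleGraph W)

/-- The main scale for the true answers. -/
noncomputable def trueScale (ω : Trials W J r) : ℕ :=
  leastScale (fun j => 32 * yesCount G ω j ∅ ≤ r) 0 J

/-- The scale of the vertex `h` for the true answers. -/
noncomputable def trueScaleOf (ω : Trials W J r) (h : W) : ℕ :=
  leastScale (fun j => 4 * yesCount G ω j {h} ≤ r) (trueScale G ω) J

/-- The vertices whose degree is large compared with the main scale. -/
noncomputable def high (ω : Trials W J r) : Finset W := {v | 2 ^ trueScale G ω < 8 * #(nbrs G v)}

variable {G} {ω : Trials W J r}

/-- Completeness puts every edgeless test set into `K`, and soundness keeps the others out, whatever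
else is known. So every later round computes the same scale. -/
theorem scale_eq {K : Set (Finset W)} (hs : Sound G K) (hc : Complete G (round1 ω) K) :
    scale ω K = trueScale G ω := by
  refine leastScale_congr _ _ fun j hj => ?_
  have : testCount ω K j ∅ = yesCount G ω j ∅ := by
    refine congrArg card (filter_congr fun t ht => ?_)
    rw [union_empty]
    refine ⟨fun h => by_contra fun hG => h (hc _ ?_ hG), fun h hK => hs _ hK h⟩
    exact mem_image.2 ⟨(j, t), mem_product.2 ⟨mem_range.2 hj, ht⟩, rfl⟩
  rw [this]

theorem trueScale_spec (hω : Typical G ω) (h : trueScale G ω < J) :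
    yesProb G J (trueScale G ω) ∅ < 1 / 16 := by
  have h1 := (leastScale_spec (fun j => 32 * yesCount G ω j ∅ ≤ r) 0 J).2
  have h2 : 32 * yesCount G ω (trueScale G ω) ∅ ≤ r := h1.resolve_right (not_le.2 h)
  have h3 := hω.pass _ h none (1 / 32) (by simp [thresholds]) (by
    have : (32 * yesCount G ω (trueScale G ω) ∅ : ℝ) ≤ r := by exact_mod_cast h2
    simp only [Option.toFinset_none]; linarith)
  simp only [Option.toFinset_none] at h3
  linarith

theorem lt_yesProb_of_lt_trueScale (hω : Typical G ω) {j : ℕ} (h : j < trueScale G ω) :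
    j < J ∧ 1 / 64 < yesProb G J j ∅ := by
  obtain ⟨h1, h2⟩ := not_of_lt_leastScale (Nat.zero_le j) h
  have h3 := hω.fail j h2 none (1 / 32) (by simp [thresholds]) (by
    have : (r : ℝ) < 32 * yesCount G ω j ∅ := by exact_mod_cast not_le.1 h1
    simp only [Option.toFinset_none]; linarith)
  simp only [Option.toFinset_none] at h3
  exact ⟨h2, by linarith⟩

theorem four_pow_mul (j : ℕ) : (4 : ℝ) ^ j * ((1 / 2) ^ j) ^ 2 = 1 := by
  rw [← pow_mul, mul_comm j 2, pow_mul, ← mul_pow]; norm_num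

theorem two_pow_mul (j : ℕ) : (2 : ℝ) ^ j * (1 / 2) ^ j = 1 := by
  rw [← mul_pow]; norm_num

/-- The scale `i` just below the main one fails its test, so its yes-probability exceeds `1/64`,
while a union bound over edges gives at most `(2·2^-i)²` per ordered adjacent pair. Thus `1024 =
64·4·4`; the summand `1` covers main scale zero. -/
theorem four_pow_trueScale_le (hω : Typical G ω) :
    4 ^ trueScale G ω ≤ 1 + 1024 * #(adjPairs G) := by
  rcases Nat.eq_zero_or_eq_succ_pred (trueScale G ω) with h | h
  · rw [h]; simp
  · set i := (trueScale G ω).pred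
    obtain ⟨h1, h2⟩ := lt_yesProb_of_lt_trueScale hω (j := i) (by omega)
    have h3 := yesProb_empty_le (J := J) (j := i) G
    have h4 : density J i ^ 2 ≤ (2 * (1 / 2) ^ i) ^ 2 :=
      pow_le_pow_left₀ density_nonneg (density_le h1.le) 2
    have h5 : (1 : ℝ) / 64 < 4 * ((1 / 2) ^ i) ^ 2 * #(adjPairs G) := by
      refine h2.trans_le (h3.trans ((mul_le_mul_of_nonneg_right h4 (Nat.cast_nonneg _)).trans_eq ?_))
      ring
    have h6 : (4 : ℝ) ^ (i + 1) ≤ 1024 * #(adjPairs G) := by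
      have := mul_le_mul_of_nonneg_left h5.le (by positivity : (0 : ℝ) ≤ 4 ^ i)
      have e := four_pow_mul i
      have : (4 : ℝ) ^ i * (1 / 64) ≤ 4 * #(adjPairs G) :=
        this.trans_eq (by linear_combination (4 * (#(adjPairs G) : ℝ)) * e)
      rw [pow_succ]; linarith
    rw [h]
    have : 4 ^ (i + 1) ≤ 1024 * #(adjPairs G) := by exact_mod_cast h6
    omega

theorem trueScale_lt (hω : Typical G ω) (hJ : 1024 * (#(adjPairs G) + 1) ≤ 2 ^ J) :
    trueScale G ω < J := by
  by_contra h
  have hJ0 : J ≠ 0 := by rintro rfl; simp at hJ; omega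
  have h1 := four_pow_trueScale_le hω
  have h2 : 4 ^ J ≤ 4 ^ trueScale G ω := Nat.pow_le_pow_right (by norm_num) (not_lt.1 h)
  have h3 : 2 ^ J ≤ 4 ^ J := Nat.pow_le_pow_left (by norm_num) J
  omega

/-- Otherwise one half of the coins hits a high vertex with probability at least `2/3` and the other
half hits a neighbour with probability at least `1/9`; but `2/27 > 1/16`. -/
theorem card_high_lt (hω : Typical G ω) (h : trueScale G ω < J) :
    #(high G ω) < 2 * 2 ^ trueScale G ω := by
  by_contra hcon
  push Not at hcon
  set s := trueScale G ω with hs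
  have h1 := trueScale_spec hω h
  -- With rounded-down division, `2 ^ s / 8 + 1` is the least degree that counts as high.
  have h2 := le_yesProb_empty (J := J) G h.le (high G ω) (2 ^ s / 8 + 1) fun v hv => by
    simp only [high, mem_filter, mem_univ, true_and, ← hs] at hv
    omega
  set p : ℝ := (1 / 2) ^ s with hp
  have hp0 : 0 < p := by positivity
  have hp1 : p ≤ 1 := pow_le_one₀ (by norm_num) (by norm_num)
  have hps : (2 : ℝ) ^ s * p = 1 := two_pow_mul s
  have h3 := one_sub_pow_mul_le hp0.le hp1 #(high G ω)
  have h4 := one_sub_pow_mul_le hp0.le hp1 (2 ^ s / 8 + 1)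
  have h5 : (2 : ℝ) ≤ #(high G ω) * p := by
    have : (2 : ℝ) * 2 ^ s ≤ #(high G ω) := by exact_mod_cast hcon
    nlinarith
  have h6 : (1 : ℝ) / 8 ≤ (2 ^ s / 8 + 1 : ℕ) * p := by
    have : (2 : ℝ) ^ s ≤ 8 * (2 ^ s / 8 + 1 : ℕ) := by
      have : 2 ^ s ≤ 8 * (2 ^ s / 8 + 1) := by omega
      exact_mod_cast this
    nlinarith
  have h7 : (1 - p) ^ #(high G ω) ≤ 1 / 3 := by
    have : 0 ≤ (1 - p) ^ #(high G ω) := pow_nonneg (by linarith) _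
    nlinarith
  have h8 : (1 - p) ^ (2 ^ s / 8 + 1) ≤ 8 / 9 := by
    have : 0 ≤ (1 - p) ^ (2 ^ s / 8 + 1) := pow_nonneg (by linarith) _
    nlinarith
  nlinarith

theorem density_mul_le {v : W} (hs : trueScale G ω ≤ J) (hv : v ∉ high G ω) :
    density J (trueScale G ω) * #(nbrs G v) ≤ 1 / 4 := by
  simp only [high, mem_filter, mem_univ, true_and, not_lt] at hv
  have h1 := density_le hs
  have h2 : (8 * #(nbrs G v) : ℝ) ≤ 2 ^ trueScale G ω := by exact_mod_cast hv
  have h3 := two_pow_mul (trueScale G ω)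
  have h4 : (0 : ℝ) ≤ (1 / 2) ^ trueScale G ω := by positivity
  have h5 : (0 : ℝ) ≤ #(nbrs G v) := Nat.cast_nonneg _
  nlinarith [mul_le_mul_of_nonneg_right h1 h5, mul_le_mul_of_nonneg_right h2 h4]

/-- Adding two low vertices raises the yes-probability to at most `1/16 + 1/4 + 1/4 < 3/4`, so the
second round contains an edgeless set through both. -/
theorem certified_of_notMem_high (hω : Typical G ω) (h : trueScale G ω < J)
    {K₁ K : Set (Finset W)} (hs₁ : Sound G K₁) (hc₁ : Complete G (round1 ω) K₁)
    (hc₂ : Complete G (round2 ω K₁) K) {u v : W} (hu : u ∉ high G ω) (hv : v ∉ high G ω)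
    (huv : ¬ G.Adj u v) : Certified K u v := by
  have h1 := trueScale_spec hω h
  have h2 := yesProb_insert_le (J := J) (j := trueScale G ω) G {v} u (by simpa using huv)
  have h3 := yesProb_insert_le (J := J) (j := trueScale G ω) G ∅ v (by simp)
  have h4 := density_mul_le h.le hu
  have h5 := density_mul_le h.le hv
  rw [insert_empty] at h3
  obtain ⟨t, ht, hut, hvt, hno⟩ := hω.pair _ h u v (by linarith)
  refine ⟨_, hc₂ _ ?_ hno, hut, hvt⟩
  rw [round2, scale_eq hs₁ hc₁, if_pos h]
  exact mem_image_of_mem _ ht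

/-- After round two the candidates of a low vertex are among its at most `2^s/8` neighbours and the
fewer than `2·2^s` high vertices. So heaviness, which the learner can see, implies high degree,
which it cannot see. -/
theorem heavy_subset_high (hω : Typical G ω) (h : trueScale G ω < J)
    {K₁ K : Set (Finset W)} (hs₁ : Sound G K₁) (hc₁ : Complete G (round1 ω) K₁) (hs : Sound G K)
    (hK : K₁ ⊆ K) (hc₂ : Complete G (round2 ω K₁) K) : heavy ω K ⊆ high G ω := by
  intro v hv
  by_contra hvh
  simp only [heavy, mem_filter, mem_univ, true_and, scale_eq hs (hc₁.mono hK)] at hv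
  have h1 : cand K v ⊆ nbrs G v ∪ high G ω := by
    intro u hu
    simp only [cand, mem_filter, mem_univ, true_and] at hu
    by_contra hcon
    simp only [mem_union, nbrs, mem_filter, mem_univ, true_and, not_or] at hcon
    exact hu.2 (certified_of_notMem_high hω h hs₁ hc₁ hc₂ hvh hcon.2 hcon.1)
  have h2 := (card_le_card h1).trans (card_union_le _ _)
  have h3 := card_high_lt hω h
  simp only [high, mem_filter, mem_univ, true_and, not_lt] at hvh
  simp only [high] at h2 h3
  omega

theorem plausible_iff (hω : Typical G ω)
    {K₁ K : Set (Finset W)} (hs₁ : Sound G K₁) (hc₁ : Complete G (round1 ω) K₁) (hs : Sound G K)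
    (hK : K₁ ⊆ K) (hc₂ : Complete G (round2 ω K₁) K) : Plausible ω K ↔ trueScale G ω < J := by
  rw [Plausible, scale_eq hs (hc₁.mono hK)]
  exact ⟨fun h => h.1, fun h => ⟨h, (card_le_card (heavy_subset_high hω h hs₁ hc₁ hs hK hc₂)).trans
    (card_high_lt hω h).le⟩⟩

/-- Guarantees that every vertex treated in round four was already tested in round three. -/
theorem heavy_anti {K K' : Set (Finset W)} (hs : Sound G K) (hs' : Sound G K')
    (hc₁ : Complete G (round1 ω) K) (hK : K ⊆ K') : heavy ω K' ⊆ heavy ω K := by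
  intro v
  simp only [heavy, mem_filter, mem_univ, true_and, scale_eq hs hc₁, scale_eq hs' (hc₁.mono hK)]
  exact fun h => h.trans_le (card_le_card (cand_anti hK v))

theorem scaleOf_eq {K₂ K : Set (Finset W)} (hs : Sound G K) (hc₁ : Complete G (round1 ω) K)
    (hp : Plausible ω K₂) (hc₃ : Complete G (round3 ω K₂) K) {h : W} (hh : h ∈ heavy ω K₂) :
    scaleOf ω K h = trueScaleOf G ω h := by
  rw [scaleOf, scale_eq hs hc₁]
  refine leastScale_congr _ _ fun j hj => ?_
  have : testCount ω K j {h} = yesCount G ω j {h} := by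
    refine congrArg card (filter_congr fun t ht => ?_)
    refine ⟨fun h => by_contra fun hG => h (hc₃ _ ?_ hG), fun h hK => hs _ hK h⟩
    rw [round3, if_pos hp]
    exact mem_image.2 ⟨(_, j, t), mem_product.2 ⟨hh, mem_product.2 ⟨mem_range.2 hj, ht⟩⟩, rfl⟩
  rw [this]

theorem trueScaleOf_spec (hω : Typical G ω) {h : W} (hh : trueScaleOf G ω h < J) :
    yesProb G J (trueScaleOf G ω h) {h} < 1 / 2 := by
  have h1 := (leastScale_spec (fun j => 4 * yesCount G ω j {h} ≤ r) (trueScale G ω) J).2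
  have h2 : 4 * yesCount G ω (trueScaleOf G ω h) {h} ≤ r := h1.resolve_right (not_le.2 hh)
  have h3 := hω.pass _ hh (some h) (1 / 4) (by simp [thresholds]) (by
    have : (4 * yesCount G ω (trueScaleOf G ω h) {h} : ℝ) ≤ r := by exact_mod_cast h2
    simp only [Option.toFinset_some]; linarith)
  simp only [Option.toFinset_some] at h3
  linarith

theorem trueScale_le_trueScaleOf (h : W) : trueScale G ω ≤ trueScaleOf G ω h :=
  (leastScale_spec _ _ _).1

/-- Above the main scale, the preceding scale fails the test of `h` with yes-probability over `1/8`,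
of which less than `1/16` is there without `h`. The neighbours of `h` must supply the rest, so its
degree is large. -/
theorem two_pow_trueScaleOf_le (hω : Typical G ω) (hs : trueScale G ω < J) (h : W) :
    2 ^ trueScaleOf G ω h ≤ 2 ^ trueScale G ω + 64 * #(nbrs G h) := by
  rcases (trueScale_le_trueScaleOf (G := G) (ω := ω) h).eq_or_lt with he | hlt
  · rw [← he]; omega
  · obtain ⟨i, hi⟩ : ∃ i, trueScaleOf G ω h = i + 1 := ⟨_, (Nat.succ_pred (by omega)).symm⟩
    obtain ⟨h1, h2⟩ := not_of_lt_leastScale (P := fun j => 4 * yesCount G ω j {h} ≤ r)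
      (lo := trueScale G ω) (J := J) (j := i) (by omega)
      (by change i < trueScaleOf G ω h; omega)
    have h3 := hω.fail i h2 (some h) (1 / 4) (by simp [thresholds]) (by
      have : (r : ℝ) < 4 * yesCount G ω i {h} := by exact_mod_cast not_le.1 h1
      simp only [Option.toFinset_some]; linarith)
    simp only [Option.toFinset_some] at h3
    have h4 := yesProb_insert_le (J := J) (j := i) G ∅ h (by simp)
    rw [insert_empty] at h4
    have h5 := yesProb_anti (J := J) G (by omega : trueScale G ω ≤ i) ∅
    have h6 := trueScale_spec hω hs
    have h7 := mul_le_mul_of_nonneg_right (density_le h2.le) (Nat.cast_nonneg (α := ℝ) #(nbrs G h))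
    have h8 : (1 : ℝ) / 16 ≤ 2 * (1 / 2) ^ i * #(nbrs G h) := by linarith
    have h9 : (2 : ℝ) ^ (i + 1) ≤ 64 * #(nbrs G h) := by
      have := mul_le_mul_of_nonneg_left h8 (by positivity : (0 : ℝ) ≤ 2 ^ i)
      have e := two_pow_mul i
      have : (2 : ℝ) ^ i * (1 / 16) ≤ 2 * #(nbrs G h) :=
        this.trans_eq (by linear_combination (2 * (#(nbrs G h) : ℝ)) * e)
      rw [pow_succ]; linarith
    rw [hi]
    have : 2 ^ (i + 1) ≤ 64 * #(nbrs G h) := by exact_mod_cast h9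
    exact this.trans (Nat.le_add_left _ _)

theorem trueScaleOf_lt (hω : Typical G ω) (hJ : 1024 * (#(adjPairs G) + 1) ≤ 2 ^ J) (h : W) :
    trueScaleOf G ω h < J := by
  by_contra hcon
  have hs := trueScale_lt hω hJ
  have h1 := two_pow_trueScaleOf_le hω hs h
  have h2 : 2 ^ J ≤ 2 ^ trueScaleOf G ω h := Nat.pow_le_pow_right two_pos (not_lt.1 hcon)
  have h3 : 2 * 2 ^ trueScale G ω ≤ 2 ^ J := by
    rw [← pow_succ']; exact Nat.pow_le_pow_right two_pos hs
  have h4 : #(nbrs G h) ≤ #(adjPairs G) := by simpa using sum_card_nbrs_le G {h}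
  omega

/-- Individual scales make the sum cheap: at most `2·2^s` heavy vertices contribute `2^s` each, and
their degrees sum to at most the number of ordered adjacent pairs. -/
theorem card_round4_le_of_typical (hω : Typical G ω) {K₁ K₂ K₃ : Set (Finset W)}
    (hs₁ : Sound G K₁) (hs₂ : Sound G K₂) (hs₃ : Sound G K₃) (h12 : K₁ ⊆ K₂) (h23 : K₂ ⊆ K₃)
    (hc₁ : Complete G (round1 ω) K₁) (hc₂ : Complete G (round2 ω K₁) K₂)
    (hc₃ : Complete G (round3 ω K₂) K₃) :
    #(round4 ω K₃) ≤ (2 * 4 ^ trueScale G ω + 64 * #(adjPairs G)) * r := by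
  refine (card_round4_le ω K₃).trans ?_
  split_ifs with hp
  · have hs : trueScale G ω < J :=
      (plausible_iff hω hs₁ hc₁ hs₃ (h12.trans h23) (hc₂.mono h23)).1 hp
    have hp₂ : Plausible ω K₂ := (plausible_iff hω hs₁ hc₁ hs₂ h12 hc₂).2 hs
    have hsub := heavy_anti hs₂ hs₃ (hc₁.mono h12) h23
    have hcard : #(heavy ω K₃) ≤ 2 * 2 ^ trueScale G ω := by
      have := hp.2
      rwa [scale_eq hs₃ (hc₁.mono (h12.trans h23))] at this
    calc ∑ h ∈ heavy ω K₃, (if scaleOf ω K₃ h < J then 2 ^ scaleOf ω K₃ h * r else 0)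
        ≤ ∑ h ∈ heavy ω K₃, (2 ^ trueScale G ω + 64 * #(nbrs G h)) * r := by
          refine sum_le_sum fun h hh => ?_
          rw [scaleOf_eq hs₃ (hc₁.mono (h12.trans h23)) hp₂ hc₃ (hsub hh)]
          split_ifs
          · exact Nat.mul_le_mul_right _ (two_pow_trueScaleOf_le hω hs h)
          · exact Nat.zero_le _
      _ = (#(heavy ω K₃) * 2 ^ trueScale G ω + 64 * ∑ h ∈ heavy ω K₃, #(nbrs G h)) * r := by
          rw [← sum_mul, sum_add_distrib, sum_const, smul_eq_mul, mul_sum]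
      _ ≤ _ := by
          refine Nat.mul_le_mul_right _ (add_le_add ?_ (Nat.mul_le_mul_left _ (sum_card_nbrs_le G _)))
          refine (Nat.mul_le_mul_right _ hcard).trans_eq ?_
          rw [mul_assoc]
          exact congrArg (2 * ·) (mul_pow 2 2 _).symm
  · exact Nat.zero_le _

/-- An open non-adjacent pair contains a high vertex. If that vertex is heavy, its open
non-neighbours are all high; if not, it has few candidates. Either way there are at most `3·2^s`,
for fewer than `2·2^s` high vertices and two orientations: `12·4^s`. -/
theorem card_uncert_le_of_typical (hω : Typical G ω) (hJ : 1024 * (#(adjPairs G) + 1) ≤ 2 ^ J)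
    {K₁ K₂ K₃ K₄ : Set (Finset W)}
    (hs₁ : Sound G K₁) (hs₂ : Sound G K₂) (hs₃ : Sound G K₃)
    (h12 : K₁ ⊆ K₂) (h23 : K₂ ⊆ K₃) (h34 : K₃ ⊆ K₄)
    (hc₁ : Complete G (round1 ω) K₁) (hc₂ : Complete G (round2 ω K₁) K₂)
    (hc₃ : Complete G (round3 ω K₂) K₃) (hc₄ : Complete G (round4 ω K₃) K₄) :
    #(uncert K₄) ≤ #(adjPairs G) + 12 * 4 ^ trueScale G ω := by
  have hs := trueScale_lt hω hJ
  have hp₂ : Plausible ω K₂ := (plausible_iff hω hs₁ hc₁ hs₂ h12 hc₂).2 hs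
  have hp₃ : Plausible ω K₃ :=
    (plausible_iff hω hs₁ hc₁ hs₃ (h12.trans h23) (hc₂.mono h23)).2 hs
  have hk := card_high_lt hω hs
  have hlow : ∀ u v, u ∉ high G ω → v ∉ high G ω → ¬ G.Adj u v → Certified K₄ u v :=
    fun u v hu hv huv => certified_of_notMem_high hω hs hs₁ hc₁ ((hc₂.mono h23).mono h34) hu hv huv
  have hheavy : ∀ h ∈ heavy ω K₃, ∀ v, v ∉ high G ω → ¬ G.Adj h v → Certified K₄ h v := by
    intro h hh v hv huv
    have hsub := heavy_anti hs₂ hs₃ (hc₁.mono h12) h23 hh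
    have he := scaleOf_eq hs₃ (hc₁.mono (h12.trans h23)) hp₂ hc₃ hsub
    have hlt := trueScaleOf_lt hω hJ h
    have h1 := trueScaleOf_spec hω hlt
    have h2 := yesProb_insert_le (J := J) (j := trueScaleOf G ω h) G {h} v
      (by simpa [SimpleGraph.adj_comm] using huv)
    have h3 := mul_le_mul_of_nonneg_right (density_anti (J := J)
      (trueScale_le_trueScaleOf (G := G) (ω := ω) h)) (Nat.cast_nonneg (α := ℝ) #(nbrs G v))
    have h4 := density_mul_le hs.le hv
    rw [pair_comm] at h2
    -- The test of `h` contributes `1/2` and the neighbours of the low vertex `v` contribute `1/4`.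
    obtain ⟨t, ht, hvt, hno⟩ := hω.single _ hlt h v (by linarith)
    refine ⟨_, hc₄ _ ?_ hno, by simp, mem_union_left _ hvt⟩
    rw [round4, if_pos hp₃, mem_biUnion]
    refine ⟨h, hh, ?_⟩
    rw [he, if_pos hlt]
    exact mem_image_of_mem (fun t => rset (trueScaleOf G ω h) (ω t) ∪ {h}) ht
  set N : W → Finset W := fun u => {v | u ≠ v ∧ ¬ Certified K₄ u v ∧ ¬ G.Adj u v} with hN
  have hNcard : ∀ u, #(N u) ≤ 3 * 2 ^ trueScale G ω := by
    intro u
    by_cases hu : u ∈ heavy ω K₃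
    · have : N u ⊆ high G ω := by
        intro v hv
        simp only [hN, mem_filter, mem_univ, true_and] at hv
        by_contra hvh
        exact hv.2.1 (hheavy u hu v hvh hv.2.2)
      have := card_le_card this
      omega
    · simp only [heavy, mem_filter, mem_univ, true_and, not_lt,
        scale_eq hs₃ (hc₁.mono (h12.trans h23))] at hu
      refine le_trans (card_le_card ?_) hu
      intro v hv
      simp only [hN, cand, mem_filter, mem_univ, true_and] at hv ⊢
      exact ⟨hv.1, fun hc => hv.2.1 (hc.mono h34)⟩
  set A : Finset (W × W) := (high G ω).biUnion fun u => (N u).image fun v => (u, v) with hA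
  have hAcard : #A ≤ 6 * 4 ^ trueScale G ω := by
    refine card_biUnion_le.trans ((sum_le_card_nsmul _ _ (3 * 2 ^ trueScale G ω)
      fun u _ => card_image_le.trans (hNcard u)).trans ?_)
    rw [smul_eq_mul]
    calc #(high G ω) * (3 * 2 ^ trueScale G ω)
        ≤ 2 * 2 ^ trueScale G ω * (3 * 2 ^ trueScale G ω) := Nat.mul_le_mul_right _ hk.le
      _ = 6 * (2 * 2) ^ trueScale G ω := by rw [mul_pow]; ring
  have hsub : uncert K₄ ⊆ adjPairs G ∪ (A ∪ A.image Prod.swap) := by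
    rintro ⟨u, v⟩ huv
    simp only [uncert, mem_filter, mem_univ, true_and] at huv
    by_cases hadj : G.Adj u v
    · exact mem_union_left _ (by simpa [adjPairs] using hadj)
    · refine mem_union_right _ ?_
      by_cases hu : u ∈ high G ω
      · refine mem_union_left _ (mem_biUnion.2 ⟨u, hu, mem_image_of_mem _ ?_⟩)
        simp [hN, huv, hadj]
      · by_cases hv : v ∈ high G ω
        · refine mem_union_right _ (mem_image.2 ⟨(v, u), mem_biUnion.2 ⟨v, hv,
            mem_image_of_mem _ ?_⟩, rfl⟩)
          simp only [hN, mem_filter, mem_univ, true_and]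
          exact ⟨huv.1.symm, fun hc => huv.2 hc.symm, fun ha => hadj ha.symm⟩
        · exact absurd (hlow u v hu hv hadj) huv.2
  have h1 := (card_le_card hsub).trans (card_union_le _ _)
  have h2 := card_union_le A (A.image Prod.swap)
  have h3 : #(A.image Prod.swap) ≤ #A := card_image_le
  omega

end Core

/-! ### Learners given by lists of rounds -/

section Rounds

variable {V W : Type} [Fintype V] [DecidableEq V] [Fintype W] [DecidableEq W] {J r : ℕ}

/-- A round chooses its queries from the set of the queries known to be edgeless. -/
abbrev Round (V : Type) := Set (Finset V) → Finset (Finset V)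

/-- The graph of all pairs that are not covered by a query known to be edgeless. -/
def graphOf (K : Set (Finset V)) : SimpleGraph V where
  Adj u v := u ≠ v ∧ ¬ Certified K u v
  symm := ⟨fun _ _ h => ⟨h.1.symm, fun hc => h.2 hc.symm⟩⟩
  loopless := ⟨fun _ h => h.1 rfl⟩

/-- The learner that runs through a list of rounds. -/
noncomputable def learner : List (Round V) → Set (Finset V) → RoundLearner V
  | [], K => .output (graphOf K)
  | R :: Rs, K => .round (R K).toList fun answers =>
      learner Rs (K ∪ {Q | (Q, false) ∈ (R K).toList.zip answers})

variable (G : SimpleGraph V)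

/-- The queries known to be edgeless after a round. -/
def step (R : Round V) (K : Set (Finset V)) : Set (Finset V) :=
  K ∪ {Q | Q ∈ R K ∧ ¬ HasEdge G Q}

/-- The queries known to be edgeless after a list of rounds. -/
def known : List (Round V) → Set (Finset V) → Set (Finset V)
  | [], K => K
  | R :: Rs, K => known Rs (step G R K)

/-- The number of queries in a list of rounds. -/
def cost : List (Round V) → Set (Finset V) → ℕ
  | [], _ => 0
  | R :: Rs, K => #(R K) + cost Rs (step G R K)

theorem edgeOracle_eq_false {Q : Finset V} : edgeOracle G Q = false ↔ ¬ HasEdge G Q := by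
  simp [edgeOracle, HasEdge]

theorem union_zip_eq_step (R : Round V) (K : Set (Finset V)) :
    K ∪ {Q | (Q, false) ∈ (R K).toList.zip ((R K).toList.map (edgeOracle G))} = step G R K := by
  unfold step
  congr 1; ext Q
  have : (R K).toList.zip ((R K).toList.map (edgeOracle G))
      = (R K).toList.map fun Q => (Q, edgeOracle G Q) := by
    have h := List.zip_map' (f := fun Q : Finset V => Q) (g := edgeOracle G) (l := (R K).toList)
    rwa [List.map_id'] at h
  simp only [this, List.mem_map, mem_toList, Prod.mk.injEq, Set.mem_ofPred_eq]
  constructor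
  · rintro ⟨Q', h1, rfl, h2⟩
    exact ⟨h1, (edgeOracle_eq_false G).1 h2⟩
  · exact fun h => ⟨Q, h.1, rfl, (edgeOracle_eq_false G).2 h.2⟩

theorem numQueries_learner (Rs : List (Round V)) (K : Set (Finset V)) :
    (learner Rs K).numQueries G = cost G Rs K := by
  induction Rs generalizing K with
  | nil => rfl
  | cons R Rs ih =>
    rw [learner, RoundLearner.numQueries, union_zip_eq_step, ih, length_toList, cost]

theorem numRounds_learner (Rs : List (Round V)) (K : Set (Finset V)) :
    (learner Rs K).numRounds G = Rs.length := by
  induction Rs generalizing K with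
  | nil => rfl
  | cons R Rs ih =>
    rw [learner, RoundLearner.numRounds, ih, List.length_cons, add_comm]

theorem result_learner (Rs : List (Round V)) (K : Set (Finset V)) :
    (learner Rs K).result G = graphOf (known G Rs K) := by
  induction Rs generalizing K with
  | nil => rfl
  | cons R Rs ih => rw [learner, RoundLearner.result, union_zip_eq_step, ih, known]

theorem known_append (Rs Rs' : List (Round V)) (K : Set (Finset V)) :
    known G (Rs ++ Rs') K = known G Rs' (known G Rs K) := by
  induction Rs generalizing K with
  | nil => rfl
  | cons R Rs ih => exact ih _

theorem cost_append (Rs Rs' : List (Round V)) (K : Set (Finset V)) :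
    cost G (Rs ++ Rs') K = cost G Rs K + cost G Rs' (known G Rs K) := by
  induction Rs generalizing K with
  | nil => simp [cost, known]
  | cons R Rs ih => simp only [List.cons_append, cost, known, ih, add_assoc]

variable {G}

theorem subset_step (R : Round V) (K : Set (Finset V)) : K ⊆ step G R K := Set.subset_union_left

theorem subset_known (Rs : List (Round V)) (K : Set (Finset V)) : K ⊆ known G Rs K := by
  induction Rs generalizing K with
  | nil => exact subset_rfl
  | cons R Rs ih => exact (subset_step R K).trans (ih _)

theorem Sound.step {K : Set (Finset V)} (h : Sound G K) (R : Round V) : Sound G (step G R K) :=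
  fun Q hQ => hQ.elim (h Q) fun h' => h'.2

theorem Sound.known {K : Set (Finset V)} (h : Sound G K) (Rs : List (Round V)) :
    Sound G (known G Rs K) := by
  induction Rs generalizing K with
  | nil => exact h
  | cons R Rs ih => exact ih (h.step R)

theorem sound_empty : Sound G ∅ := fun _ h => h.elim

theorem complete_step (R : Round V) (K : Set (Finset V)) : Complete G (R K) (step G R K) :=
  fun _ hQ hG => Or.inr ⟨hQ, hG⟩

/-- The last round: all pairs that are still open are queried. -/
noncomputable def lastRound : Round V := fun K => (uncert K).image fun p => {p.1, p.2}

/-- Source of the Las Vegas property: soundness never discards an edge, and each open non-edge is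
certified by its own two-element query, however badly earlier rounds went. -/
theorem graphOf_step_lastRound {K : Set (Finset V)} (h : Sound G K) :
    graphOf (step G lastRound K) = G := by
  ext u v
  constructor
  · rintro ⟨hne, hc⟩
    by_contra hadj
    have h1 : ¬ Certified K u v := fun h' => hc (h'.mono (subset_step _ _))
    refine hc ⟨{u, v}, complete_step _ _ _ (mem_image.2 ⟨(u, v), by simp [uncert, hne, h1], rfl⟩) ?_,
      by simp, by simp⟩
    rintro ⟨a, ha, b, hb, hab⟩
    simp only [mem_insert, mem_singleton] at ha hb
    rcases ha with rfl | rfl <;> rcases hb with rfl | rfl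
    · exact G.loopless.irrefl _ hab
    · exact hadj hab
    · exact hadj hab.symm
    · exact G.loopless.irrefl _ hab
  · rintro hadj
    exact ⟨hadj.ne, fun ⟨Q, hQ, hu, hv⟩ => h.step _ Q hQ ⟨u, hu, v, hv, hadj⟩⟩

theorem result_learner_append_lastRound (Rs : List (Round V)) :
    (learner (Rs ++ [lastRound]) ∅).result G = G := by
  rw [result_learner, known_append]
  exact graphOf_step_lastRound (sound_empty.known Rs)

/-! ### Lifting rounds along a hash function -/

/-- The vertices that are hashed into `Q`. -/
def preim (g : V → W) (Q : Finset W) : Finset V := {v | g v ∈ Q}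

/-- The sets of hash values whose vertices are known to span no edge. -/
def collapse (g : V → W) (K : Set (Finset V)) : Set (Finset W) := {Q | preim g Q ∈ K}

/-- The round on the vertices given by a round on the hash values, skipped if `skip` holds. -/
noncomputable def lift (g : V → W) (skip : Set (Finset V) → Prop) (R : Round W) : Round V :=
  fun K => if skip K then ∅ else (R (collapse g K)).image (preim g)

/-- The four rounds of the group testing strategy, applied to the hash values. -/
noncomputable def phase (g : V → W) (skip : Set (Finset V) → Prop) (ω : Trials W J r) :
    List (Round V) :=
  [lift g skip fun _ => round1 ω, lift g skip (round2 ω), lift g skip (round3 ω),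
    lift g skip (round4 ω)]

theorem card_lift_le (g : V → W) (skip : Set (Finset V) → Prop) (R : Round W)
    (K : Set (Finset V)) : #(lift g skip R K) ≤ if skip K then 0 else #(R (collapse g K)) := by
  unfold lift
  split_ifs
  · simp
  · exact card_image_le

theorem collapse_mono (g : V → W) {K K' : Set (Finset V)} (h : K ⊆ K') :
    collapse g K ⊆ collapse g K' := fun _ hQ => h hQ

theorem cost_phase_le_worst (g : V → W) (skip : Set (Finset V) → Prop) (ω : Trials W J r)
    (K : Set (Finset V)) : cost G (phase g skip ω) K ≤ 6 * 4 ^ J * ((J + 1) * r) := by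
  have h : ∀ (R : Round W) K, #(lift g skip R K) ≤ #(R (collapse g K)) := fun R K =>
    (card_lift_le g skip R K).trans (by split_ifs <;> omega)
  simp only [phase, cost]
  rw [add_zero, ← add_assoc, ← add_assoc]
  exact (add_le_add (add_le_add (add_le_add (h _ _) (h _ _)) (h _ _)) (h _ _)).trans
    (card_rounds_le_worst ω _ _ _)

/-- The hash function turns the edge-detecting queries of `H` into those of `G`. -/
def Compatible (g : V → W) (G : SimpleGraph V) (H : SimpleGraph W) : Prop :=
  ∀ Q, HasEdge G (preim g Q) ↔ HasEdge H Q

variable {H : SimpleGraph W} {g : V → W}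

theorem Sound.collapse (hg : Compatible g G H) {K : Set (Finset V)} (h : Sound G K) :
    Sound H (collapse g K) := fun Q hQ hH => h _ hQ ((hg Q).2 hH)

theorem complete_collapse_step (hg : Compatible g G H) {skip : Set (Finset V) → Prop}
    {K : Set (Finset V)} (hK : ¬ skip K) (R : Round W) :
    Complete H (R (collapse g K)) (collapse g (EdgeQuery.step G (lift g skip R) K)) := by
  intro Q hQ hno
  refine complete_step _ _ _ ?_ fun h => hno ((hg Q).1 h)
  rw [lift, if_neg hK]
  exact mem_image_of_mem _ hQ

/-- The cost of the phase for typical trials. -/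
theorem cost_phase_le_of_typical (hg : Compatible g G H) {skip : Set (Finset V) → Prop}
    (hskip : ∀ K K', K ⊆ K' → skip K → skip K') {ω : Trials W J r} (hω : Typical H ω)
    {K : Set (Finset V)} (hK : Sound G K) :
    cost G (phase g skip ω) K ≤ J * r + 4 ^ trueScale H ω * r
      + 2 * 2 ^ trueScale H ω * (J * r) + (2 * 4 ^ trueScale H ω + 64 * #(adjPairs H)) * r := by
  simp only [phase, cost]
  set K₁ := EdgeQuery.step G (lift g skip fun _ => round1 ω) K with hK₁
  set K₂ := EdgeQuery.step G (lift g skip (round2 ω)) K₁ with hK₂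
  set K₃ := EdgeQuery.step G (lift g skip (round3 ω)) K₂ with hK₃
  have s₁ : Sound G K₁ := hK.step _
  have s₂ : Sound G K₂ := s₁.step _
  have s₃ : Sound G K₃ := s₂.step _
  have i₀ : K ⊆ K₁ := subset_step _ _
  have i₁ : K₁ ⊆ K₂ := subset_step _ _
  have i₂ : K₂ ⊆ K₃ := subset_step _ _
  have c₁ : ¬ skip K → Complete H (round1 ω) (EdgeQuery.collapse g K₁) := fun h =>
    complete_collapse_step hg h fun _ => round1 ω
  have c₂ : ¬ skip K₁ → Complete H (round2 ω (EdgeQuery.collapse g K₁))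
    (EdgeQuery.collapse g K₂) := fun h => complete_collapse_step hg h _
  have c₃ : ¬ skip K₂ → Complete H (round3 ω (EdgeQuery.collapse g K₂))
    (EdgeQuery.collapse g K₃) := fun h => complete_collapse_step hg h _
  have b₁ : #(lift g skip (fun _ => round1 ω) K) ≤ J * r := by
    refine (card_lift_le g skip _ K).trans ?_
    split_ifs
    · exact Nat.zero_le _
    · exact card_round1_le ω
  have b₂ : #(lift g skip (round2 ω) K₁) ≤ 4 ^ trueScale H ω * r := by
    refine (card_lift_le g skip _ K₁).trans ?_
    split_ifs with h
    · exact Nat.zero_le _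
    · refine (card_round2_le ω _).trans ?_
      rw [scale_eq (s₁.collapse hg) (c₁ fun h' => h (hskip _ _ i₀ h'))]
      split_ifs <;> omega
  have b₃ : #(lift g skip (round3 ω) K₂) ≤ 2 * 2 ^ trueScale H ω * (J * r) := by
    refine (card_lift_le g skip _ K₂).trans ?_
    split_ifs with h
    · exact Nat.zero_le _
    · refine (card_round3_le ω _).trans ?_
      rw [scale_eq (s₂.collapse hg) ((c₁ fun h' => h (hskip _ _ (i₀.trans i₁) h')).mono
        (collapse_mono g i₁))]
      split_ifs
      · exact le_rfl
      · exact Nat.zero_le _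
  have b₄ : #(lift g skip (round4 ω) K₃)
      ≤ (2 * 4 ^ trueScale H ω + 64 * #(adjPairs H)) * r := by
    refine (card_lift_le g skip _ K₃).trans ?_
    split_ifs with h
    · exact Nat.zero_le _
    · exact card_round4_le_of_typical hω (s₁.collapse hg) (s₂.collapse hg) (s₃.collapse hg)
        (collapse_mono g i₁) (collapse_mono g i₂)
        (c₁ fun h' => h (hskip _ _ (i₀.trans (i₁.trans i₂)) h'))
        (c₂ fun h' => h (hskip _ _ (i₁.trans i₂) h')) (c₃ fun h' => h (hskip _ _ i₂ h'))
  omega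

/-- After the phase, for typical trials only few pairs are open, unless rounds were skipped. -/
theorem skip_or_card_uncert_le (hg : Compatible g G H) {skip : Set (Finset V) → Prop}
    (hskip : ∀ K K', K ⊆ K' → skip K → skip K') {ω : Trials W J r} (hω : Typical H ω)
    (hJ : 1024 * (#(adjPairs H) + 1) ≤ 2 ^ J) {K : Set (Finset V)} (hK : Sound G K) :
    skip (known G (phase g skip ω) K) ∨
      #(uncert (collapse g (known G (phase g skip ω) K)))
        ≤ #(adjPairs H) + 12 * 4 ^ trueScale H ω := by
  refine or_iff_not_imp_left.2 fun hns => ?_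
  simp only [phase, known] at hns ⊢
  set K₁ := EdgeQuery.step G (lift g skip fun _ => round1 ω) K with hK₁
  set K₂ := EdgeQuery.step G (lift g skip (round2 ω)) K₁ with hK₂
  set K₃ := EdgeQuery.step G (lift g skip (round3 ω)) K₂ with hK₃
  have s₁ : Sound G K₁ := hK.step _
  have s₂ : Sound G K₂ := s₁.step _
  have s₃ : Sound G K₃ := s₂.step _
  have i₀ : K ⊆ K₁ := subset_step _ _
  have i₁ : K₁ ⊆ K₂ := subset_step _ _
  have i₂ : K₂ ⊆ K₃ := subset_step _ _
  have i₃ := subset_step (G := G) (lift g skip (round4 ω)) K₃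
  -- Skipping persists as knowledge grows, so if it does not hold at the end, no round was skipped.
  have n₃ : ¬ skip K₃ := fun h => hns (hskip _ _ i₃ h)
  have n₂ : ¬ skip K₂ := fun h => n₃ (hskip _ _ i₂ h)
  have n₁ : ¬ skip K₁ := fun h => n₂ (hskip _ _ i₁ h)
  have n₀ : ¬ skip K := fun h => n₁ (hskip _ _ i₀ h)
  exact card_uncert_le_of_typical hω hJ (s₁.collapse hg) (s₂.collapse hg) (s₃.collapse hg)
    (collapse_mono g i₁) (collapse_mono g i₂) (collapse_mono g i₃)
    (complete_collapse_step hg n₀ fun _ => round1 ω) (complete_collapse_step hg n₁ _)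
    (complete_collapse_step hg n₂ _) (complete_collapse_step hg n₃ _)

/-! ### Hashing and the round that reads off the endpoints of the edges -/

/-- The graph on the hash values. -/
def hashGraph (g : V → W) (G : SimpleGraph V) : SimpleGraph W where
  Adj a b := a ≠ b ∧ ∃ u v, g u = a ∧ g v = b ∧ G.Adj u v
  symm := ⟨fun _ _ ⟨h, u, v, hu, hv, huv⟩ => ⟨h.symm, v, u, hv, hu, huv.symm⟩⟩
  loopless := ⟨fun _ h => h.1 rfl⟩

/-- The hash function separates the endpoints of the edges. -/
def Separates (g : V → W) (G : SimpleGraph V) : Prop :=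
  ∀ x x' y y', G.Adj x x' → G.Adj y y' → g x = g y → x = y

/-- The ends of an edge get different hash values, so no edge degenerates to a loop. -/
theorem Separates.compatible (h : Separates g G) : Compatible g G (hashGraph g G) := by
  intro Q
  constructor
  · rintro ⟨u, hu, v, hv, huv⟩
    simp only [preim, mem_filter, mem_univ, true_and] at hu hv
    exact ⟨g u, hu, g v, hv, fun he => huv.ne (h u v v u huv huv.symm he), u, v, rfl, rfl, huv⟩
  · rintro ⟨a, ha, b, hb, -, u, v, rfl, rfl, huv⟩
    exact ⟨u, by simpa [preim] using ha, v, by simpa [preim] using hb, huv⟩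

theorem compatible_id : Compatible id G G := by
  intro Q
  have : preim id Q = Q := by ext; simp [preim]
  rw [this]

theorem collapse_id (K : Set (Finset V)) : collapse id K = K := by
  ext Q
  have : preim id Q = Q := by ext; simp [preim]
  simp [collapse, this]

theorem card_adjPairs_hashGraph_le : #(adjPairs (hashGraph g G)) ≤ #(adjPairs G) := by
  refine (card_le_card (t := (adjPairs G).image (Prod.map g g)) ?_).trans card_image_le
  rintro ⟨a, b⟩ h
  simp only [adjPairs, mem_filter, mem_univ, true_and] at h
  obtain ⟨-, u, v, rfl, rfl, huv⟩ := h
  exact mem_image.2 ⟨(u, v), by simpa [adjPairs] using huv, rfl⟩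

theorem prob_not_separates_le [Nonempty W] :
    prob (fun g : V → W => ¬ Separates g G) ≤ #(adjPairs G) ^ 2 / Fintype.card W := by
  set S := (adjPairs G).image Prod.fst
  have hS : #S ≤ #(adjPairs G) := card_image_le
  have h1 : prob (fun g : V → W => ¬ Separates g G)
      ≤ prob (fun g : V → W => ∃ p ∈ S ×ˢ S, p.1 ≠ p.2 ∧ g p.1 = g p.2) := by
    refine prob_mono fun g hg => ?_
    simp only [Separates, not_forall] at hg
    obtain ⟨x, x', y, y', hx, hy, he, hne⟩ := hg
    refine ⟨(x, y), mem_product.2 ⟨mem_image.2 ⟨(x, x'), ?_, rfl⟩, mem_image.2 ⟨(y, y'), ?_, rfl⟩⟩,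
      hne, he⟩ <;> simpa [adjPairs]
  refine h1.trans ((prob_exists_le_card_mul _ _ (1 / Fintype.card W : ℝ) fun p _ => ?_).trans ?_)
  · by_cases hp : p.1 = p.2
    · simp only [hp, ne_eq, not_true, false_and, prob, if_false]
      rw [avg_const]; positivity
    · refine (prob_mono fun g h => h.2).trans ?_
      rw [prob, avg_update p.1]
      refine (avg_mono fun g => ?_).trans_eq (avg_const _)
      simp [avg, Function.update_of_ne (Ne.symm hp)]
  · rw [card_product, mul_one_div, sq]
    gcongr
    exact_mod_cast Nat.mul_le_mul hS hS

/-- For every open pair of hash values, the vertices with the first hash value are split by the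
binary digits of their codes, and every part is queried together with the second class. -/
noncomputable def bitRound (code : V → ℕ) (L B : ℕ) (g : V → W) : Round V := fun K =>
  if #(uncert (collapse g K)) ≤ B then
    (uncert (collapse g K) ×ˢ range L ×ˢ (univ : Finset Bool)).image fun q =>
      ({v | g v = q.1.1 ∧ (code v).testBit q.2.1 = q.2.2 ∨ g v = q.1.2} : Finset V)
  else ∅

theorem card_bitRound_le (code : V → ℕ) (L B : ℕ) (g : V → W) (K : Set (Finset V)) :
    #(bitRound code L B g K) ≤
      if #(uncert (collapse g K)) ≤ B then #(uncert (collapse g K)) * (L * 2) else 0 := by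
  unfold bitRound
  split_ifs
  · refine card_image_le.trans ?_
    simp [card_product]
  · simp

theorem exists_testBit_ne {a b L : ℕ} (ha : a < 2 ^ L) (hb : b < 2 ^ L) (h : a ≠ b) :
    ∃ i < L, a.testBit i ≠ b.testBit i := by
  by_contra hcon
  push Not at hcon
  refine h (Nat.eq_of_testBit_eq fun i => ?_)
  rcases lt_or_ge i L with hi | hi
  · exact hcon i hi
  · have := Nat.pow_le_pow_right two_pos hi
    rw [Nat.testBit_lt_two_pow (ha.trans_le this), Nat.testBit_lt_two_pow (hb.trans_le this)]

/-- By separation `x` is the only non-isolated vertex of its class, and a digit where it differs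
from `u` removes it. Any edge would then lie inside the class of `v`, which has at most one
non-isolated vertex. -/
theorem exists_bit_query_not_hasEdge {code : V → ℕ} {L : ℕ} (hcode : Function.Injective code)
    (hL : ∀ v, code v < 2 ^ L) (hg : Separates g G) {u v : V} {x x' : V} (hxx : G.Adj x x')
    (hx : g x = g u) (hxu : x ≠ u) :
    ∃ i < L, ¬ HasEdge G
      {w | g w = g u ∧ (code w).testBit i = (code u).testBit i ∨ g w = g v} := by
  obtain ⟨i, hi, hne⟩ := exists_testBit_ne (hL x) (hL u) (hcode.ne hxu)
  refine ⟨i, hi, ?_⟩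
  rintro ⟨p, hp, q, hq, hpq⟩
  simp only [mem_filter, mem_univ, true_and] at hp hq
  have key : ∀ y y', G.Adj y y' → (g y = g u ∧ (code y).testBit i = (code u).testBit i ∨ g y = g v)
      → g y = g v := by
    rintro y y' hy (⟨h1, h2⟩ | h)
    · have := hg y y' x x' hy hxx (h1.trans hx.symm)
      subst this
      exact absurd h2 hne
    · exact h
  exact hpq.ne (hg p q q p hpq hpq.symm ((key p q hpq hp).trans (key q p hpq.symm hq).symm))

/-- If the hash function separates the edges and only few pairs of hash values are open, then after
reading off the endpoints only the edges are open. -/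
theorem uncert_step_bitRound_subset {code : V → ℕ} {L B : ℕ} (hcode : Function.Injective code)
    (hL : ∀ v, code v < 2 ^ L) (hL0 : 0 < L) (hg : Separates g G) {K : Set (Finset V)}
    (hB : #(uncert (collapse g K)) ≤ B) (hBW : B + 1 < Fintype.card W) :
    uncert (step G (bitRound code L B g) K) ⊆ adjPairs G := by
  rintro ⟨u, v⟩ huv
  simp only [uncert, mem_filter, mem_univ, true_and] at huv
  obtain ⟨hne, hnc⟩ := huv
  by_contra hadj
  simp only [adjPairs, mem_filter, mem_univ, true_and] at hadj
  have hlift : ∀ a b, Certified (collapse g K) a b → ∀ x y, (g x = a ∨ g x = b) →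
      (g y = a ∨ g y = b) → Certified (step G (bitRound code L B g) K) x y := by
    rintro a b ⟨Q, hQ, ha, hb⟩ x y hx hy
    refine ⟨preim g Q, subset_step _ _ hQ, ?_, ?_⟩
    · simp only [preim, mem_filter, mem_univ, true_and]
      rcases hx with hx | hx <;> rwa [hx]
    · simp only [preim, mem_filter, mem_univ, true_and]
      rcases hy with hy | hy <;> rwa [hy]
  -- Two vertices of one class are covered by any certified pair involving that class; if there were
  -- none, at least `Fintype.card W - 1 > B` pairs would be open.
  by_cases huv : g u = g v
  · have h1 : ∃ b, g u ≠ b ∧ Certified (collapse g K) (g u) b := by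
      by_contra hcon
      push Not at hcon
      have h2 : #(univ.erase (g u)) ≤ #(uncert (collapse g K)) := by
        refine card_le_card_of_injOn (fun b => (g u, b)) (fun b hb => ?_) fun b _ c _ h => ?_
        · have hb' : g u ≠ b := (ne_of_mem_erase hb).symm
          simpa [uncert, hb'] using hcon b hb'
        · simpa using h
      rw [card_erase_of_mem (mem_univ _), card_univ] at h2
      omega
    obtain ⟨b, -, hb⟩ := h1
    exact hnc (hlift _ _ hb u v (Or.inl rfl) (Or.inl huv.symm))
  · have hopen : ¬ Certified (collapse g K) (g u) (g v) := fun h =>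
      hnc (hlift _ _ h u v (Or.inl rfl) (Or.inr rfl))
    have hmem : ∀ x y : V, g x ≠ g y → ¬ Certified (collapse g K) (g x) (g y) → ∀ i < L,
        ¬ HasEdge G {w | g w = g x ∧ (code w).testBit i = (code x).testBit i ∨ g w = g y} →
        Certified (step G (bitRound code L B g) K) x y := by
      intro x y hxy hxy' i hi hno
      refine ⟨_, complete_step _ _ _ ?_ hno, by simp, by simp⟩
      rw [bitRound, if_pos hB]
      exact mem_image.2 ⟨((g x, g y), i, (code x).testBit i), by simp [uncert, hxy, hxy', hi], rfl⟩
    by_cases hu : ∃ x x', G.Adj x x' ∧ g x = g u ∧ x ≠ u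
    · obtain ⟨x, x', hxx, hx, hxu⟩ := hu
      obtain ⟨i, hi, hno⟩ := exists_bit_query_not_hasEdge (v := v) hcode hL hg hxx hx hxu
      exact hnc (hmem u v huv hopen i hi hno)
    · by_cases hv : ∃ y y', G.Adj y y' ∧ g y = g v ∧ y ≠ v
      · obtain ⟨y, y', hyy, hy, hyv⟩ := hv
        obtain ⟨i, hi, hno⟩ := exists_bit_query_not_hasEdge (v := u) hcode hL hg hyy hy hyv
        exact hnc (hmem v u (Ne.symm huv) (fun h => hopen h.symm) i hi hno).symm
      -- Now only `u` and `v` can be non-isolated in their classes, so any digit works; `0 < L`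
      -- supplies digit zero.
      · push Not at hu hv
        refine hnc (hmem u v huv hopen 0 hL0 ?_)
        rintro ⟨p, hp, q, hq, hpq⟩
        simp only [mem_filter, mem_univ, true_and] at hp hq
        have key : ∀ y y', G.Adj y y' → (g y = g u ∧ (code y).testBit 0 = (code u).testBit 0
            ∨ g y = g v) → y = u ∨ y = v := by
          rintro y y' hy (⟨h1, -⟩ | h)
          · exact Or.inl (hu y y' hy h1)
          · exact Or.inr (hv y y' hy h)
        rcases key p q hpq hp with rfl | rfl <;> rcases key q p hpq.symm hq with rfl | rfl
        · exact G.loopless.irrefl _ hpq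
        · exact hadj hpq
        · exact hadj hpq.symm
        · exact G.loopless.irrefl _ hpq

end Rounds

/-! ### The cost of the whole strategy -/

section Strategy

variable {V W : Type} [Fintype V] [DecidableEq V] [Fintype W] [DecidableEq W] {J r L l m : ℕ}

/-- First the group testing strategy on hash values and the reading of the endpoints, then the group
testing strategy on the vertices unless only few pairs are open, and finally all open pairs. -/
noncomputable def strategy {J₁ r₁ J₂ r₂ : ℕ} (code : V → ℕ) (L B : ℕ) (g : V → W)
    (ω₁ : Trials W J₁ r₁) (ω₂ : Trials V J₂ r₂) : List (Round V) :=
  phase g (fun _ => False) ω₁ ++ [bitRound code L B g] ++ phase id (fun K => #(uncert K) ≤ B) ω₂ ++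
    [lastRound]

theorem card_lastRound_le (K : Set (Finset V)) : #(lastRound K) ≤ #(uncert K) := card_image_le

theorem card_uncert_le_sq (K : Set (Finset V)) : #(uncert K) ≤ Fintype.card V ^ 2 := by
  rw [sq, ← Fintype.card_prod]; exact card_le_univ _

theorem card_adjPairs_le_sq (G : SimpleGraph V) : #(adjPairs G) ≤ Fintype.card V ^ 2 := by
  rw [sq, ← Fintype.card_prod]; exact card_le_univ _

variable {G : SimpleGraph V}

theorem cost_strategy {J₁ r₁ J₂ r₂ : ℕ} (code : V → ℕ) (L B : ℕ) (g : V → W)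
    (ω₁ : Trials W J₁ r₁) (ω₂ : Trials V J₂ r₂) :
    ∃ K₁ K₂ K₃, K₁ = known G (phase g (fun _ => False) ω₁) ∅ ∧
      K₂ = step G (bitRound code L B g) K₁ ∧
      K₃ = known G (phase id (fun K => #(uncert K) ≤ B) ω₂) K₂ ∧
      cost G (strategy code L B g ω₁ ω₂) ∅ = cost G (phase g (fun _ => False) ω₁) ∅ +
        #(bitRound code L B g K₁) + cost G (phase id (fun K => #(uncert K) ≤ B) ω₂) K₂ +
        #(lastRound K₃) := by
  refine ⟨_, _, _, rfl, rfl, rfl, ?_⟩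
  simp only [strategy, cost_append, known_append, cost, known, add_zero]

theorem uncert_le_anti (B : ℕ) : ∀ K K' : Set (Finset V), K ⊆ K' → #(uncert K) ≤ B →
    #(uncert K') ≤ B := fun _ _ h hB => (card_le_card (uncert_anti h)).trans hB

theorem cost_phase_of_skip {g : V → W} {skip : Set (Finset V) → Prop}
    (hskip : ∀ K K', K ⊆ K' → skip K → skip K') (ω : Trials W J r) {K : Set (Finset V)}
    (hK : skip K) : cost G (phase g skip ω) K = 0 := by
  have h : ∀ (R : Round W) K', K ⊆ K' → #(lift g skip R K') = 0 := by
    intro R K' hK'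
    rw [lift, if_pos (hskip _ _ hK' hK), card_empty]
  have hs := fun R K' => subset_step (G := G) R K'
  simp only [phase, cost, add_zero]
  rw [h _ _ subset_rfl, h _ _ (hs _ _), h _ _ ((hs _ _).trans (hs _ _)),
    h _ _ (((hs _ _).trans (hs _ _)).trans (hs _ _))]

theorem two_pow_sq (s : ℕ) : (2 ^ s) ^ 2 = 4 ^ s := by rw [← pow_mul, mul_comm, pow_mul]; norm_num

/-- The cost of a phase, up to the cost of the estimates. -/
theorem cost_phase_le {H : SimpleGraph W} {g : V → W} (hg : Compatible g G H)
    {skip : Set (Finset V) → Prop} (hskip : ∀ K K', K ⊆ K' → skip K → skip K')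
    {ω : Trials W J r} (hω : Typical H ω) (hm : 1 ≤ m) (hD : #(adjPairs H) ≤ 2 * m)
    {K : Set (Finset V)} (hK : Sound G K) :
    ∃ x, x ^ 2 ≤ 2049 * m ∧
      cost G (phase g skip ω) K ≤ J * r + 6300 * m * r + 2 * x * (J * r) := by
  refine ⟨2 ^ trueScale H ω, ?_, ?_⟩
  · have := four_pow_trueScale_le hω
    rw [two_pow_sq]; omega
  · have h1 := cost_phase_le_of_typical hg hskip hω hK
    have h2 := four_pow_trueScale_le hω
    have h3 : 4 ^ trueScale H ω * r ≤ 2049 * m * r := Nat.mul_le_mul_right _ (by omega)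
    have h4 : (2 * 4 ^ trueScale H ω + 64 * #(adjPairs H)) * r ≤ 4226 * m * r :=
      Nat.mul_le_mul_right _ (by omega)
    have h5 : 2049 * m * r + 4226 * m * r ≤ 6300 * m * r := by
      rw [← add_mul, ← add_mul]; gcongr; norm_num
    omega

theorem cost_phase_le' {H : SimpleGraph W} {g : V → W} (hg : Compatible g G H)
    {skip : Set (Finset V) → Prop} (hskip : ∀ K K', K ⊆ K' → skip K → skip K')
    {ω : Trials W J r} (hω : Typical H ω) (hm : 1 ≤ m) (hD : #(adjPairs H) ≤ 2 * m)
    (hJ : 1 ≤ J) {K : Set (Finset V)} (hK : Sound G K) :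
    cost G (phase g skip ω) K ≤ 10400 * m * (J * r) := by
  obtain ⟨x, hx, hc⟩ := cost_phase_le hg hskip hω hm hD hK
  have h1 : x ≤ 2049 * m := (Nat.le_self_pow two_ne_zero x).trans hx
  have h2 : r ≤ J * r := Nat.le_mul_of_pos_left _ hJ
  calc _ ≤ J * r + 6300 * m * r + 2 * x * (J * r) := hc
    _ ≤ m * (J * r) + 6300 * m * (J * r) + 2 * (2049 * m) * (J * r) := by
      refine add_le_add (add_le_add (Nat.le_mul_of_pos_left _ hm) ?_) ?_ <;> gcongr
    _ = 10399 * m * (J * r) := by ring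
    _ ≤ _ := by gcongr; norm_num

/-- The pairs left open by the second phase. -/
theorem card_uncert_known_phase_le {ω : Trials V J r} (hω : Typical G ω) (hm : 1 ≤ m)
    (hD : #(adjPairs G) ≤ 2 * m) (hJ : 1024 * (#(adjPairs G) + 1) ≤ 2 ^ J) (B : ℕ)
    {K : Set (Finset V)} (hK : Sound G K) :
    #(uncert (known G (phase id (fun K => #(uncert K) ≤ B) ω) K)) ≤ B + 25000 * m := by
  rcases skip_or_card_uncert_le compatible_id (uncert_le_anti B) hω hJ hK with h | h
  · omega
  · rw [collapse_id] at h
    have := four_pow_trueScale_le hω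
    omega

theorem card_bitRound_le_mul (code : V → ℕ) (L B : ℕ) (g : V → W) (K : Set (Finset V)) :
    #(bitRound code L B g K) ≤ B * (L * 2) := by
  refine (card_bitRound_le code L B g K).trans ?_
  split_ifs with h
  · exact Nat.mul_le_mul_right _ h
  · exact Nat.zero_le _

/-- The number of open pairs that is regarded as small. -/
def openBound (L : ℕ) : ℕ := 30000 * L ^ 2

/-- The cost of the first phase and of reading off the endpoints in the worst case. -/
def worstFirst (L l : ℕ) : ℕ :=
  6 * 4 ^ (2 * l + 12) * ((2 * l + 12 + 1) * (10000 * l)) + openBound L * (L * 2)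

/-- The cost of the second phase in the worst case. -/
def worstSecond (L : ℕ) : ℕ := 6 * 4 ^ (2 * L + 12) * ((2 * L + 12 + 1) * (4000 * L))

variable {code : V → ℕ} {g : V → W} {ω₁ : Trials W (2 * l + 12) (10000 * l)}
  {ω₂ : Trials V (2 * L + 12) (4000 * L)}

theorem cost_strategy_le_worst : cost G (strategy code L (openBound L) g ω₁ ω₂) ∅ ≤
    worstFirst L l + worstSecond L + Fintype.card V ^ 2 := by
  obtain ⟨K₁, K₂, K₃, h₁, h₂, h₃, h⟩ := cost_strategy (G := G) code L (openBound L) g ω₁ ω₂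
  rw [h, worstFirst, worstSecond]
  exact add_le_add (add_le_add (add_le_add (cost_phase_le_worst _ _ _ _)
    (card_bitRound_le_mul _ _ _ _ _)) (cost_phase_le_worst _ _ _ _))
    ((card_lastRound_le _).trans (card_uncert_le_sq _))

theorem enough_scales (hV : Fintype.card V ≤ 2 ^ L) :
    1024 * (#(adjPairs G) + 1) ≤ 2 ^ (2 * L + 12) := by
  have h1 := card_adjPairs_le_sq G
  have h2 : Fintype.card V ^ 2 ≤ (2 ^ L) ^ 2 := Nat.pow_le_pow_left hV 2
  have h3 : 2 ^ (2 * L + 12) = 4096 * (2 ^ L) ^ 2 := by rw [pow_add, ← pow_mul, mul_comm L]; ring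
  have h4 : 1 ≤ (2 ^ L) ^ 2 := Nat.one_le_pow _ _ (by positivity)
  omega

/-- The cost when the trials of the second phase are typical. -/
theorem cost_strategy_le_of_typical (hm : 1 ≤ m) (hD : #(adjPairs G) ≤ 2 * m) (hL : 1 ≤ L)
    (hV : Fintype.card V ≤ 2 ^ L) (hω₂ : Typical G ω₂) :
    cost G (strategy code L (openBound L) g ω₁ ω₂) ∅ ≤ worstFirst L l + 600000000 * (m * L ^ 2) := by
  obtain ⟨K₁, K₂, K₃, h₁, h₂, h₃, h⟩ := cost_strategy (G := G) code L (openBound L) g ω₁ ω₂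
  have hs₁ : Sound G K₁ := h₁ ▸ sound_empty.known _
  have hs₂ : Sound G K₂ := h₂ ▸ hs₁.step _
  have e1 := cost_phase_le_worst (G := G) g (fun _ => False) ω₁ ∅
  have e2 := card_bitRound_le_mul code L (openBound L) g K₁
  have e3 := cost_phase_le' compatible_id (uncert_le_anti (openBound L)) hω₂ hm hD (by omega) hs₂
  have e4 := (card_lastRound_le K₃).trans (h₃ ▸ card_uncert_known_phase_le hω₂ hm hD
    (enough_scales hV) (openBound L) hs₂)
  have e5 : 10400 * m * ((2 * L + 12) * (4000 * L)) ≤ 10400 * m * ((14 * L) * (4000 * L)) := by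
    gcongr; omega
  have e6 : 10400 * m * ((14 * L) * (4000 * L)) = 582400000 * (m * L ^ 2) := by ring
  have e7 : openBound L + 25000 * m ≤ 55000 * (m * L ^ 2) := by
    have : 1 * L ^ 2 ≤ m * L ^ 2 := Nat.mul_le_mul_right _ hm
    have : m ≤ m * L ^ 2 := Nat.le_mul_of_pos_right _ (by positivity)
    rw [openBound]; omega
  rw [h, worstFirst]
  omega

/-- The critical term is `x L²` with `x = O(√m)`. Since `L ≤ √m`, `x L ≤ 46 m`, where `46² = 2116`
exceeds `2049`. -/
theorem cost_second_le (hm : 1 ≤ m) (hD : #(adjPairs G) ≤ 2 * m) (hL : 1 ≤ L)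
    (hmL : L ^ 2 ≤ m) (hω₂ : Typical G ω₂) {K : Set (Finset V)}
    (hK : Sound G K) :
    cost G (phase id (fun K => #(uncert K) ≤ openBound L) ω₂) K ≤ 40000000 * (m * L) := by
  obtain ⟨x, hx, hc⟩ := cost_phase_le compatible_id (uncert_le_anti (openBound L)) hω₂ hm hD hK
  have hxL : x * L ≤ 46 * m := by
    have : (x * L) ^ 2 ≤ (46 * m) ^ 2 := by
      calc (x * L) ^ 2 = x ^ 2 * L ^ 2 := mul_pow _ _ _
        _ ≤ 2049 * m * m := Nat.mul_le_mul hx hmL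
        _ ≤ 2116 * (m * m) := by rw [mul_assoc]; gcongr; norm_num
        _ = _ := by ring
    exact (Nat.pow_le_pow_iff_left two_ne_zero).1 this
  have e1 : (2 * L + 12) * (4000 * L) ≤ 56000 * L ^ 2 := by
    calc (2 * L + 12) * (4000 * L) ≤ (14 * L) * (4000 * L) := by gcongr; omega
      _ = _ := by ring
  calc _ ≤ (2 * L + 12) * (4000 * L) + 6300 * m * (4000 * L)
        + 2 * x * ((2 * L + 12) * (4000 * L)) := hc
    _ ≤ 56000 * L ^ 2 + 6300 * m * (4000 * L) + 2 * x * (56000 * L ^ 2) := by gcongr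
    _ = 56000 * L ^ 2 + 25200000 * (m * L) + 112000 * ((x * L) * L) := by ring
    _ ≤ 56000 * (m * L) + 25200000 * (m * L) + 112000 * ((46 * m) * L) := by
        gcongr
        exact hmL.trans (Nat.le_mul_of_pos_right _ hL)
    _ = 30408000 * (m * L) := by ring
    _ ≤ _ := by gcongr; norm_num

theorem cost_last_le (hm : 1 ≤ m) (hD : #(adjPairs G) ≤ 2 * m) (hL : 1 ≤ L)
    (hV : Fintype.card V ≤ 2 ^ L) (hmL : L ^ 2 ≤ m) (hω₂ : Typical G ω₂) {K : Set (Finset V)}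
    (hK : Sound G K) :
    #(lastRound (known G (phase id (fun K => #(uncert K) ≤ openBound L) ω₂) K))
      ≤ 60000 * (m * L) := by
  have e4 := (card_lastRound_le _).trans (card_uncert_known_phase_le hω₂ hm hD
    (enough_scales hV) (openBound L) hK)
  have : m ≤ m * L := Nat.le_mul_of_pos_right _ hL
  have : openBound L ≤ 30000 * m := Nat.mul_le_mul_left _ hmL
  omega

theorem cost_strategy_le_of_large (hm : 1 ≤ m) (hD : #(adjPairs G) ≤ 2 * m) (hL : 1 ≤ L)
    (hV : Fintype.card V ≤ 2 ^ L) (hmL : L ^ 2 ≤ m) (hω₂ : Typical G ω₂) :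
    cost G (strategy code L (openBound L) g ω₁ ω₂) ∅ ≤ worstFirst L l + 50000000 * (m * L) := by
  obtain ⟨K₁, K₂, K₃, h₁, h₂, h₃, h⟩ := cost_strategy (G := G) code L (openBound L) g ω₁ ω₂
  have hs₂ : Sound G K₂ := h₂ ▸ (h₁ ▸ sound_empty.known _ : Sound G K₁).step _
  have e1 := cost_phase_le_worst (G := G) g (fun _ => False) ω₁ ∅
  have e2 := card_bitRound_le_mul code L (openBound L) g K₁
  have e3 := cost_second_le hm hD hL hmL hω₂ hs₂
  have e4 := cost_last_le hm hD hL hV hmL hω₂ hs₂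
  rw [h, worstFirst]
  subst h₃
  omega

/-- The cost when the hash function separates the edges and all trials are typical. -/
theorem cost_strategy_le_of_good (hcode : Function.Injective code) (hcodeL : ∀ v, code v < 2 ^ L)
    (hm : 1 ≤ m) (hD : #(adjPairs G) ≤ 2 * m) (hL : 1 ≤ L) (hl : 1 ≤ l) (hLl : L ≤ 2 ^ l)
    (hlL : l ^ 2 ≤ 4 * L) (hV : Fintype.card V ≤ 2 ^ L) (hW : Fintype.card W = 2 ^ (20 * l))
    (hg : Separates g G) (hω₁ : Typical (hashGraph g G) ω₁) (hω₂ : Typical G ω₂) :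
    cost G (strategy code L (openBound L) g ω₁ ω₂) ∅ ≤ 6000000000 * (m * L) := by
  obtain ⟨K₁, K₂, K₃, h₁, h₂, h₃, h⟩ := cost_strategy (G := G) code L (openBound L) g ω₁ ω₂
  have hs₁ : Sound G K₁ := h₁ ▸ sound_empty.known _
  have hs₂ : Sound G K₂ := h₂ ▸ hs₁.step _
  have hDH : #(adjPairs (hashGraph g G)) ≤ 2 * m := card_adjPairs_hashGraph_le.trans hD
  have e1 : cost G (phase g (fun _ => False) ω₁) ∅ ≤ 5824000000 * (m * L) := by
    refine (cost_phase_le' hg.compatible (skip := fun _ => False) (fun _ _ _ h => h) hω₁ hm hDH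
      (by omega) sound_empty).trans ?_
    calc 10400 * m * ((2 * l + 12) * (10000 * l)) ≤ 10400 * m * ((14 * l) * (10000 * l)) := by
          gcongr; omega
      _ = 1456000000 * (m * l ^ 2) := by ring
      _ ≤ 1456000000 * (m * (4 * L)) := by gcongr
      _ = _ := by ring
  have hmm : m ≤ m * L := Nat.le_mul_of_pos_right _ hL
  -- For `m ≥ L ^ 2` the second phase is affordable. Otherwise reading off the endpoints leaves only
  -- edges open, fewer than `openBound L`, and the second phase is skipped.
  rcases le_or_gt (L ^ 2) m with hmL | hmL
  · have e2 := card_bitRound_le_mul code L (openBound L) g K₁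
    have e3 := cost_second_le hm hD hL hmL hω₂ hs₂
    have e4 := cost_last_le hm hD hL hV hmL hω₂ hs₂
    have e5 : openBound L * (L * 2) ≤ 60000 * (m * L) := by
      calc openBound L * (L * 2) = 60000 * (L ^ 2 * L) := by rw [openBound]; ring
        _ ≤ _ := by gcongr
    rw [h]
    subst h₃
    omega
  · have hJ : 1024 * (#(adjPairs (hashGraph g G)) + 1) ≤ 2 ^ (2 * l + 12) := by
      have h3 : 2 ^ (2 * l + 12) = 4096 * (2 ^ l) ^ 2 := by
        rw [pow_add, ← pow_mul, mul_comm l]; ring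
      have h4 : L ^ 2 ≤ (2 ^ l) ^ 2 := Nat.pow_le_pow_left hLl 2
      omega
    have e0 : #(uncert (collapse g K₁)) ≤ 25000 * m := by
      rcases skip_or_card_uncert_le hg.compatible (skip := fun _ => False) (fun _ _ _ h => h) hω₁ hJ
        sound_empty
        with h' | h'
      · exact h'.elim
      · have := four_pow_trueScale_le hω₁
        rw [← h₁] at h'
        omega
    have e0B : #(uncert (collapse g K₁)) ≤ openBound L := by rw [openBound]; omega
    have hBW : openBound L + 1 < Fintype.card W := by
      have a1 : 2 ^ (20 * l) = (2 ^ l) ^ 2 * (2 ^ l) ^ 18 := by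
        rw [← pow_add, ← pow_mul]; ring_nf
      have a2 : 2 ≤ 2 ^ l := Nat.le_self_pow (by omega) 2
      have a3 : 2 ^ 18 ≤ (2 ^ l) ^ 18 := Nat.pow_le_pow_left a2 18
      have a4 : L ^ 2 ≤ (2 ^ l) ^ 2 := Nat.pow_le_pow_left hLl 2
      have a5 : L ^ 2 * 2 ^ 18 ≤ (2 ^ l) ^ 2 * (2 ^ l) ^ 18 := Nat.mul_le_mul a4 a3
      have a6 : 1 ≤ L ^ 2 := Nat.one_le_pow _ _ hL
      rw [hW, a1, openBound]
      omega
    have e2 : #(bitRound code L (openBound L) g K₁) ≤ 50000 * (m * L) := by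
      refine (card_bitRound_le code L _ g K₁).trans ?_
      rw [if_pos e0B]
      exact (Nat.mul_le_mul_right _ e0).trans_eq (by ring)
    have hsub : uncert K₂ ⊆ adjPairs G :=
      h₂ ▸ uncert_step_bitRound_subset hcode hcodeL hL hg e0B hBW
    have hU := (card_le_card hsub).trans hD
    have e3 : cost G (phase id (fun K => #(uncert K) ≤ openBound L) ω₂) K₂ = 0 :=
      cost_phase_of_skip (uncert_le_anti _) _ (by rw [openBound]; omega)
    have e4 : #(lastRound K₃) ≤ 2 * m :=
      (card_lastRound_le K₃).trans ((card_le_card (uncert_anti (h₃ ▸ subset_known _ _))).trans hU)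
    rw [h, e3]
    omega

end Strategy

/-! ### The expected cost -/

section Expectation

variable {V W : Type} [Fintype V] [DecidableEq V] [Fintype W] [DecidableEq W] {L l m : ℕ}

theorem avg_le_of_exceptions {Ω : Type*} [Fintype Ω] [Nonempty Ω] {f : Ω → ℝ} {p q : Ω → Prop}
    {a b c : ℝ} (ha : 0 ≤ a) (hb : 0 ≤ b) (h1 : ∀ x, ¬ p x → ¬ q x → f x ≤ a)
    (h2 : ∀ x, ¬ q x → f x ≤ b) (h3 : ∀ x, f x ≤ c) :
    avg f ≤ a + (b * prob p + c * prob q) := by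
  rw [prob, prob, ← avg_mul_left, ← avg_mul_left, ← avg_add]
  nth_rw 1 [← avg_const (Ω := Ω) a]
  rw [← avg_add]
  refine avg_mono fun x => ?_
  by_cases hq : q x
  · have := h3 x
    by_cases hp : p x <;> simp only [hp, hq, if_true, if_false] <;> linarith
  · by_cases hp : p x
    · have := h2 x hq
      simp only [hp, hq, if_true, if_false]; linarith
    · have := h1 x hp hq
      simp only [hp, hq, if_false]; linarith

theorem exp_neg_natCast_le (k : ℕ) : Real.exp (-k) ≤ (1 / 2) ^ k := by
  have h : Real.exp (-1) ≤ 1 / 2 := by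
    rw [Real.exp_neg, one_div]
    exact inv_anti₀ two_pos (by have := Real.add_one_le_exp (1 : ℝ); linarith)
  calc Real.exp (-k) = Real.exp (-1) ^ k := by rw [← Real.exp_nat_mul]; ring_nf
    _ ≤ _ := pow_le_pow_left₀ (Real.exp_pos _).le h k

theorem worstFirst_le (hLl : L ≤ 2 ^ l) (hl : 1 ≤ l) :
    worstFirst L l ≤ 20000000000000 * (2 ^ l) ^ 6 := by
  have h1 : l ≤ 2 ^ l := Nat.lt_two_pow_self.le
  have h2 : 1 ≤ 2 ^ l := Nat.one_le_two_pow
  have h3 : 4 ^ (2 * l + 12) = 16777216 * (2 ^ l) ^ 4 := by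
    rw [show (4 : ℕ) = 2 ^ 2 from rfl, ← pow_mul, ← pow_mul, mul_add, pow_add]; ring
  calc worstFirst L l
      ≤ 6 * (16777216 * (2 ^ l) ^ 4) * ((15 * 2 ^ l) * (10000 * 2 ^ l))
        + 30000 * (2 ^ l) ^ 2 * (2 ^ l * 2) := by
        rw [worstFirst, openBound, h3]
        gcongr
        omega
    _ = 15099494400000 * (2 ^ l) ^ 6 + 60000 * (2 ^ l) ^ 3 := by ring
    _ ≤ 15099494400000 * (2 ^ l) ^ 6 + 60000 * (2 ^ l) ^ 6 := by
        gcongr; all_goals omega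
    _ = 15099494460000 * (2 ^ l) ^ 6 := by ring
    _ ≤ _ := by gcongr; norm_num

theorem worst_le (hLl : L ≤ 2 ^ l) (hl : 1 ≤ l) (hlL : 2 ^ l ≤ 2 * L) {n : ℕ}
    (hn : n ≤ 2 ^ L) :
    worstFirst L l + worstSecond L + n ^ 2 ≤ 2000000000000000 * (2 ^ L) ^ 6 := by
  have h1 : L ≤ 2 ^ L := Nat.lt_two_pow_self.le
  have h2 : 1 ≤ 2 ^ L := Nat.one_le_two_pow
  have h3 : 4 ^ (2 * L + 12) = 16777216 * (2 ^ L) ^ 4 := by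
    rw [show (4 : ℕ) = 2 ^ 2 from rfl, ← pow_mul, ← pow_mul, mul_add, pow_add]; ring
  have e1 : worstFirst L l ≤ 1280000000000000 * (2 ^ L) ^ 6 := by
    calc _ ≤ 20000000000000 * (2 ^ l) ^ 6 := worstFirst_le hLl hl
      _ ≤ 20000000000000 * (2 * 2 ^ L) ^ 6 := by gcongr 20000000000000 * ?_ ^ 6; omega
      _ = _ := by ring
  have e2 : worstSecond L ≤ 7000000000000 * (2 ^ L) ^ 6 := by
    calc worstSecond L ≤ 6 * (16777216 * (2 ^ L) ^ 4) * ((15 * 2 ^ L) * (4000 * 2 ^ L)) := by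
          rw [worstSecond, h3]
          gcongr
          omega
      _ = 6039797760000 * (2 ^ L) ^ 6 := by ring
      _ ≤ _ := by gcongr; norm_num
  have e3 : n ^ 2 ≤ (2 ^ L) ^ 6 :=
    (Nat.pow_le_pow_left hn 2).trans (Nat.pow_le_pow_right h2 (by norm_num))
  omega

variable {G : SimpleGraph V}

/-- The seeds of the strategy. -/
abbrev Seeds (V W : Type) (L l : ℕ) :=
  (V → W) × Trials W (2 * l + 12) (10000 * l) × Trials V (2 * L + 12) (4000 * L)

/-- Here `4000/200 = 20` gives `2^{-20L}`; the factors `J` and `|V|²` of the union bound lose `3L`.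
-/
theorem prob_second_not_typical_le [Nonempty V] [Nonempty W] (hL : 1 ≤ L)
    (hV : Fintype.card V ≤ 2 ^ L) :
    prob (fun s : Seeds V W L l => ¬ Typical G s.2.2) ≤ 140 * ((1 / 2) ^ L) ^ 17 := by
  have h1 : prob (fun s : Seeds V W L l => ¬ Typical G s.2.2)
      = prob (fun ω : Trials V (2 * L + 12) (4000 * L) => ¬ Typical G ω) :=
    (prob_snd (Ω := V → W) fun s : Trials W (2 * l + 12) (10000 * l) ×
      Trials V (2 * L + 12) (4000 * L) => ¬ Typical G s.2).trans
      (prob_snd (Ω := Trials W (2 * l + 12) (10000 * l)) fun ω => ¬ Typical G ω)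
  have h2 := prob_not_typical_le (J := 2 * L + 12) (r := 4000 * L) G
  have h3 : Real.exp (-(((4000 * L : ℕ) : ℝ) / 200)) ≤ ((1 / 2) ^ L) ^ 20 := by
    refine le_trans (le_of_eq ?_) ((exp_neg_natCast_le (20 * L)).trans_eq ?_)
    · push_cast; ring_nf
    · rw [← pow_mul, mul_comm]
  have h4 : ((2 * L + 12 : ℕ) : ℝ) ≤ 14 * 2 ^ L := by
    have : 2 * L + 12 ≤ 14 * 2 ^ L := by
      have : L < 2 ^ L := Nat.lt_two_pow_self
      omega
    exact_mod_cast this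
  have h5 : (Fintype.card V : ℝ) ≤ 2 ^ L := by exact_mod_cast hV
  have h6 := two_pow_mul L
  rw [h1]
  calc _ ≤ 10 * ((2 * L + 12 : ℕ) : ℝ) * Fintype.card V ^ 2 *
        Real.exp (-(((4000 * L : ℕ) : ℝ) / 200)) := h2
    _ ≤ 10 * (14 * 2 ^ L) * (2 ^ L) ^ 2 * ((1 / 2) ^ L) ^ 20 := by gcongr
    _ = 140 * (2 ^ L * (1 / 2) ^ L) ^ 3 * ((1 / 2) ^ L) ^ 17 := by ring
    _ = _ := by rw [h6]; ring

/-- Hash collisions contribute `(2·2^{6l})² / 2^{20l} = 4·2^{-8l}`. Atypical trials contribute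
`2^{-50l}` times a union bound of order `2^{41l}`. -/
theorem prob_first_bad_le [Nonempty V] [Nonempty W] (hD : #(adjPairs G) ≤ 2 * m) (hl : 1 ≤ l)
    (hm : m ≤ (2 ^ l) ^ 6) (hW : Fintype.card W = 2 ^ (20 * l)) :
    prob (fun s : Seeds V W L l => ¬ Separates s.1 G ∨ ¬ Typical (hashGraph s.1 G) s.2.1)
      ≤ 144 * ((1 / 2) ^ l) ^ 8 := by
  have h6 := two_pow_mul l
  have hp0 : (0 : ℝ) ≤ (1 / 2) ^ l := by positivity
  have hp1 : (1 / 2 : ℝ) ^ l ≤ 1 := pow_le_one₀ (by norm_num) (by norm_num)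
  have hWr : (Fintype.card W : ℝ) = (2 ^ l) ^ 20 := by
    rw [hW, mul_comm, pow_mul]; push_cast; rfl
  have h1 : prob (fun s : Seeds V W L l => ¬ Separates s.1 G) ≤ 4 * ((1 / 2) ^ l) ^ 8 := by
    have e : prob (fun s : Seeds V W L l => ¬ Separates s.1 G)
        = prob (fun g : V → W => ¬ Separates g G) :=
      prob_fst fun g : V → W => ¬ Separates g G
    have hD' : (#(adjPairs G) : ℝ) ≤ 2 * (2 ^ l) ^ 6 := by
      have : #(adjPairs G) ≤ 2 * (2 ^ l) ^ 6 := by omega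
      exact_mod_cast this
    rw [e]
    refine prob_not_separates_le.trans ?_
    rw [hWr, div_le_iff₀ (by positivity)]
    calc (#(adjPairs G) : ℝ) ^ 2 ≤ (2 * (2 ^ l) ^ 6) ^ 2 := by gcongr
      _ = 4 * (2 ^ l) ^ 12 * (2 ^ l * (1 / 2) ^ l) ^ 8 := by rw [h6]; ring
      _ = _ := by ring
  have h2 : prob (fun s : Seeds V W L l => ¬ Typical (hashGraph s.1 G) s.2.1)
      ≤ 140 * ((1 / 2) ^ l) ^ 8 := by
    have h3 : Real.exp (-(((10000 * l : ℕ) : ℝ) / 200)) ≤ ((1 / 2) ^ l) ^ 50 := by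
      refine le_trans (le_of_eq ?_) ((exp_neg_natCast_le (50 * l)).trans_eq ?_)
      · push_cast; ring_nf
      · rw [← pow_mul, mul_comm]
    have h4 : ((2 * l + 12 : ℕ) : ℝ) ≤ 14 * 2 ^ l := by
      have : 2 * l + 12 ≤ 14 * 2 ^ l := by
        have : l < 2 ^ l := Nat.lt_two_pow_self
        omega
      exact_mod_cast this
    rw [prob, avg_prod]
    refine le_trans (avg_mono (g := fun _ => 140 * ((1 / 2) ^ l) ^ 8) fun g => ?_)
      (avg_const _).le
    refine le_trans (le_of_eq (prob_fst (Ω' := Trials V (2 * L + 12) (4000 * L))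
      fun ω : Trials W (2 * l + 12) (10000 * l) => ¬ Typical (hashGraph g G) ω)) ?_
    calc _ ≤ 10 * ((2 * l + 12 : ℕ) : ℝ) * Fintype.card W ^ 2 *
          Real.exp (-(((10000 * l : ℕ) : ℝ) / 200)) := prob_not_typical_le _
      _ ≤ 10 * (14 * 2 ^ l) * ((2 ^ l) ^ 20) ^ 2 * ((1 / 2) ^ l) ^ 50 := by rw [hWr]; gcongr
      _ = 140 * (2 ^ l * (1 / 2) ^ l) ^ 41 * ((1 / 2) ^ l) ^ 9 := by ring
      _ = 140 * ((1 / 2) ^ l) ^ 9 := by rw [h6]; ring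
      _ ≤ _ := mul_le_mul_of_nonneg_left (pow_le_pow_of_le_one hp0 hp1 (by norm_num)) (by norm_num)
  linarith [prob_or_le (fun s : Seeds V W L l => ¬ Separates s.1 G)
    (fun s => ¬ Typical (hashGraph s.1 G) s.2.1)]

theorem avg_cost_strategy_le [Nonempty V] [Nonempty W] {code : V → ℕ}
    (hcode : Function.Injective code) (hcodeL : ∀ v, code v < 2 ^ L) (hm : 1 ≤ m)
    (hD : #(adjPairs G) ≤ 2 * m) (hL : 1 ≤ L) (hl : 1 ≤ l) (hLl : L ≤ 2 ^ l)
    (hlL : 2 ^ l ≤ 2 * L) (hV : Fintype.card V ≤ 2 ^ L) (hW : Fintype.card W = 2 ^ (20 * l)) :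
    avg (fun s : Seeds V W L l =>
      (cost G (strategy code L (openBound L) s.1 s.2.1 s.2.2) ∅ : ℝ)) ≤ 10 ^ 18 * (m * L) := by
  have hmL : (1 : ℝ) ≤ m * L := by exact_mod_cast Nat.mul_le_mul hm hL
  have hl2 : l ^ 2 ≤ 2 * 2 ^ l := by
    clear * -
    rcases Nat.lt_or_ge l 4 with h | h
    · interval_cases l <;> norm_num
    · induction l, h using Nat.le_induction with
      | base => norm_num
      | succ k hk ih => rw [pow_succ 2 k]; nlinarith
  have hwf : (worstFirst L l : ℝ) ≤ 20000000000000 * (2 ^ l) ^ 6 := by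
    exact_mod_cast worstFirst_le hLl hl
  have hP2 := prob_second_not_typical_le (G := G) (W := W) (l := l) hL hV
  have hc : ((worstFirst L l + worstSecond L + Fintype.card V ^ 2 : ℕ) : ℝ)
      ≤ 2000000000000000 * (2 ^ L) ^ 6 := by
    exact_mod_cast worst_le hLl hl hlL hV
  have hcP : (2000000000000000 * (2 ^ L) ^ 6 : ℝ) *
      prob (fun s : Seeds V W L l => ¬ Typical G s.2.2) ≤ 280000000000000000 := by
    have hp1 : ((1 / 2 : ℝ) ^ L) ^ 11 ≤ 1 := by
      rw [← pow_mul]; exact pow_le_one₀ (by norm_num) (by norm_num)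
    calc _ ≤ (2000000000000000 * (2 ^ L) ^ 6 : ℝ) * (140 * ((1 / 2) ^ L) ^ 17) := by gcongr
      _ = 280000000000000000 * (2 ^ L * (1 / 2) ^ L) ^ 6 * ((1 / 2) ^ L) ^ 11 := by ring
      _ ≤ 280000000000000000 * (2 ^ L * (1 / 2) ^ L) ^ 6 * 1 := by gcongr
      _ = _ := by rw [two_pow_mul]; norm_num
  have hworst : ∀ s : Seeds V W L l,
      (cost G (strategy code L (openBound L) s.1 s.2.1 s.2.2) ∅ : ℝ)
        ≤ 2000000000000000 * (2 ^ L) ^ 6 := fun s =>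
    le_trans (by exact_mod_cast cost_strategy_le_worst) hc
  -- For `m ≤ 2^{6l}` a bad first phase costs `O(2^{8l})` with probability `O(2^{-8l})`. For larger
  -- `m` even the worst first phase is O(m), so its failure needs no separate account. An atypical
  -- second phase costs `O(2^{6L})` with probability `O(2^{-17L})`.
  rcases le_or_gt m ((2 ^ l) ^ 6) with hmM | hmM
  · have hP1 := prob_first_bad_le (L := L) hD hl hmM hW
    have h := avg_le_of_exceptions (Ω := Seeds V W L l)
      (f := fun s => (cost G (strategy code L (openBound L) s.1 s.2.1 s.2.2) ∅ : ℝ))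
      (p := fun s => ¬ Separates s.1 G ∨ ¬ Typical (hashGraph s.1 G) s.2.1)
      (q := fun s => ¬ Typical G s.2.2)
      (a := 6000000000 * (m * L)) (b := 20600000000000 * (2 ^ l) ^ 8)
      (c := 2000000000000000 * (2 ^ L) ^ 6) (by positivity) (by positivity) ?_ ?_
      hworst
    · have hbP : (20600000000000 * (2 ^ l) ^ 8 : ℝ) * prob (fun s : Seeds V W L l =>
          ¬ Separates s.1 G ∨ ¬ Typical (hashGraph s.1 G) s.2.1) ≤ 2966400000000000 := by
        calc _ ≤ (20600000000000 * (2 ^ l) ^ 8 : ℝ) * (144 * ((1 / 2) ^ l) ^ 8) := by gcongr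
          _ = 2966400000000000 * (2 ^ l * (1 / 2) ^ l) ^ 8 := by ring
          _ = _ := by rw [two_pow_mul]; norm_num
      linarith
    · intro s hp hq
      push Not at hp hq
      have := cost_strategy_le_of_good hcode hcodeL hm hD hL hl hLl (by omega) hV hW hp.1 hp.2 hq
      exact_mod_cast this
    · intro s hq
      push Not at hq
      have h1 := cost_strategy_le_of_typical (l := l) (code := code) (g := s.1) (ω₁ := s.2.1)
        hm hD hL hV hq
      have h2 : m * L ^ 2 ≤ (2 ^ l) ^ 6 * (2 ^ l) ^ 2 :=
        Nat.mul_le_mul hmM (Nat.pow_le_pow_left hLl 2)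
      have h3 : (2 ^ l) ^ 6 ≤ (2 ^ l) ^ 8 := Nat.pow_le_pow_right Nat.one_le_two_pow (by norm_num)
      have h4 := worstFirst_le hLl hl
      have h5 : (2 ^ l) ^ 6 * (2 ^ l) ^ 2 = (2 ^ l) ^ 8 := by ring
      have h6 : cost G (strategy code L (openBound L) s.1 s.2.1 s.2.2) ∅
          ≤ 20600000000000 * (2 ^ l) ^ 8 := by omega
      exact_mod_cast h6
  · have hLm : L ^ 2 ≤ m := by
      refine le_trans ?_ hmM.le
      exact (Nat.pow_le_pow_left hLl 2).trans (Nat.pow_le_pow_right Nat.one_le_two_pow (by norm_num))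
    have h := avg_le_of_exceptions (Ω := Seeds V W L l)
      (f := fun s => (cost G (strategy code L (openBound L) s.1 s.2.1 s.2.2) ∅ : ℝ))
      (p := fun _ => False) (q := fun s => ¬ Typical G s.2.2)
      (a := 20000050000000 * (m * L)) (b := 20000050000000 * (m * L))
      (c := 2000000000000000 * (2 ^ L) ^ 6) (by positivity) (by positivity) ?_ ?_ hworst
    · have h0 : prob (fun _ : Seeds V W L l => False) = 0 := by
        simp only [prob, if_false]; exact avg_const _
      rw [h0] at h
      linarith
    all_goals
      have key : ∀ s : Seeds V W L l, ¬ ¬ Typical G s.2.2 →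
          (cost G (strategy code L (openBound L) s.1 s.2.1 s.2.2) ∅ : ℝ)
            ≤ 20000050000000 * (m * L) := by
        intro s hq
        push Not at hq
        have h1 := cost_strategy_le_of_large (l := l) (code := code) (g := s.1) (ω₁ := s.2.1)
          hm hD hL hV hLm hq
        have h4 := worstFirst_le hLl hl
        have h5 : m ≤ m * L := Nat.le_mul_of_pos_right _ hL
        have h6 : cost G (strategy code L (openBound L) s.1 s.2.1 s.2.2) ∅
            ≤ 20000050000000 * (m * L) := by omega
        exact_mod_cast h6
    · exact fun s _ hq => key s hq
    · exact key

end Expectation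

/-! ### Randomized learners -/

section Randomized

variable {V : Type} [Fintype V] [DecidableEq V]

/-- The randomized learner that draws a uniform seed and then runs through a list of rounds. -/
noncomputable def uniformLearner (S : Type) [Fintype S] [Nonempty S] (R : S → List (Round V)) :
    RandomizedLearner V where
  Seed := S
  law := PMF.uniformOfFintype S
  run s := learner (R s) ∅

theorem expectedQueries_uniformLearner (S : Type) [Fintype S] [Nonempty S]
    (R : S → List (Round V)) (G : SimpleGraph V) :
    (uniformLearner S R).expectedQueries G = ENNReal.ofReal (avg fun s => (cost G (R s) ∅ : ℝ)) := by
  have hS : (0 : ℝ) < Fintype.card S := card_cast_pos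
  unfold RandomizedLearner.expectedQueries uniformLearner
  simp only [numQueries_learner, PMF.uniformOfFintype_apply]
  rw [tsum_fintype, ← mul_sum, avg, ENNReal.ofReal_div_of_pos hS, ENNReal.ofReal_natCast,
    ENNReal.ofReal_sum_of_nonneg fun _ _ => Nat.cast_nonneg _, ENNReal.div_eq_inv_mul]
  simp only [ENNReal.ofReal_natCast]

theorem card_adjPairs_le {G : SimpleGraph V} {m : ℕ} (h : G.edgeSet.ncard ≤ m) :
    #(adjPairs G) ≤ 2 * m := by
  have h1 : adjPairs G ⊆ (univ : Finset G.Dart).image fun d => d.toProd := by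
    intro p hp
    simp only [adjPairs, mem_filter, mem_univ, true_and] at hp
    exact mem_image.2 ⟨⟨p, hp⟩, mem_univ _, rfl⟩
  refine ((card_le_card h1).trans card_image_le).trans ?_
  rw [card_univ, SimpleGraph.dart_card_eq_twice_card_edges]
  rw [Set.ncard_eq_toFinset_card'] at h
  refine Nat.mul_le_mul_left 2 (le_trans (le_of_eq ?_) h)
  congr!

end Randomized

/-! ### Growth of log*, and the learners for large and small `n` -/

theorem tendsto_iteratedLog (k : ℕ) :
    Filter.Tendsto (iteratedLog k) Filter.atTop Filter.atTop := by
  induction k with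
  | zero => exact Filter.tendsto_id
  | succ k ih =>
    have : iteratedLog (k + 1) = iteratedLog k ∘ Real.logb 2 := by
      ext x; simp [iteratedLog]
    rw [this]
    exact ih.comp (Real.tendsto_logb_atTop one_lt_two)

/-- The function `log*` is unbounded. -/
theorem eventually_le_logStar (r : ℕ) : ∃ n₀ : ℕ, ∀ n ≥ n₀, r ≤ logStar n := by
  have h : ∀ᶠ n : ℕ in Filter.atTop, ∀ k ∈ range r, 1 < iteratedLog k (n : ℝ) :=
    (Filter.eventually_all_finset _).2 fun k _ =>
      ((tendsto_iteratedLog k).comp tendsto_natCast_atTop_atTop).eventually_gt_atTop 1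
  obtain ⟨n₀, hn₀⟩ := Filter.eventually_atTop.1 h
  refine ⟨n₀, fun n hn => le_csInf (exists_iteratedLog_le_one n) fun k hk => ?_⟩
  by_contra hlt
  exact absurd hk (not_le.2 (hn₀ n hn k (mem_range.2 (not_le.1 hlt))))

theorem one_le_logStar {n : ℕ} (hn : 2 ≤ n) : 1 ≤ logStar n := by
  refine le_csInf (exists_iteratedLog_le_one n) fun k hk => ?_
  rcases Nat.eq_zero_or_pos k with rfl | h
  · have : (n : ℝ) ≤ 1 := hk
    have : n ≤ 1 := by exact_mod_cast this
    omega
  · exact h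

theorem exists_learner_of_ten_le_logStar {n : ℕ} (hn : 2 ≤ n) (hlog : 10 ≤ logStar n) :
    ∃ A : RandomizedLearner (Fin n), A.IsLasVegas ∧ A.RunsInRounds (logStar n) ∧
      ∀ m : ℕ, 1 ≤ m → ∀ G : SimpleGraph (Fin n), G.edgeSet.ncard ≤ m →
        A.expectedQueries G ≤ ENNReal.ofReal (2 * 10 ^ 18 * m * Real.logb 2 n) := by
  set L := Nat.log 2 n + 1 with hL
  set l := Nat.log 2 L + 1 with hl
  have hLl : L < 2 ^ l := Nat.lt_pow_succ_log_self one_lt_two _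
  have hlL : 2 ^ l ≤ 2 * L := by
    rw [hl, pow_succ, mul_comm]
    exact Nat.mul_le_mul_left _ (Nat.pow_log_le_self 2 (by omega))
  have hV : n < 2 ^ L := Nat.lt_pow_succ_log_self one_lt_two _
  have : Nonempty (Fin n) := ⟨⟨0, by omega⟩⟩
  refine ⟨uniformLearner (Seeds (Fin n) (Fin (2 ^ (20 * l))) L l) fun s =>
    strategy (fun v => v.val) L (openBound L) s.1 s.2.1 s.2.2, ?_, ?_, ?_⟩
  · intro G s _
    exact result_learner_append_lastRound _
  · intro G s _
    -- The strategy has `4 + 1 + 4 + 1 = 10` rounds.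
    refine le_trans (le_of_eq ?_) hlog
    exact numRounds_learner _ _ _
  · intro m hm G hG
    rw [expectedQueries_uniformLearner]
    refine ENNReal.ofReal_le_ofReal ((avg_cost_strategy_le Fin.val_injective
      (fun v => v.2.trans hV) hm (card_adjPairs_le hG) (by omega) (by omega) hLl.le hlL
      (by rw [Fintype.card_fin]; exact hV.le) (Fintype.card_fin _)).trans ?_)
    have h1 : (Nat.log 2 n : ℝ) ≤ Real.logb 2 n := Real.natLog_le_logb n 2
    have h2 : 1 ≤ Nat.log 2 n := Nat.log_pos one_lt_two hn
    have h3 : (1 : ℝ) ≤ Nat.log 2 n := by exact_mod_cast h2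
    have h4 : (L : ℝ) ≤ 2 * Real.logb 2 n := by rw [hL]; push_cast; linarith
    calc (10 : ℝ) ^ 18 * (m * L) ≤ 10 ^ 18 * (m * (2 * Real.logb 2 n)) := by gcongr
      _ = _ := by ring

theorem exists_learner_of_two_le {n : ℕ} (hn : 2 ≤ n) :
    ∃ A : RandomizedLearner (Fin n), A.IsLasVegas ∧ A.RunsInRounds (logStar n) ∧
      ∀ m : ℕ, 1 ≤ m → ∀ G : SimpleGraph (Fin n), G.edgeSet.ncard ≤ m →
        A.expectedQueries G ≤ ENNReal.ofReal (n ^ 2 * m * Real.logb 2 n) := by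
  refine ⟨uniformLearner Unit fun _ => [lastRound], ?_, ?_, ?_⟩
  · intro G s _
    exact result_learner_append_lastRound []
  · intro G s _
    refine le_trans (le_of_eq ?_) (one_le_logStar hn)
    exact numRounds_learner _ _ _
  · intro m hm G _
    rw [expectedQueries_uniformLearner, avg_const]
    refine ENNReal.ofReal_le_ofReal ?_
    have h1 : cost G [lastRound] ∅ ≤ n ^ 2 := by
      have := (card_lastRound_le (∅ : Set (Finset (Fin n)))).trans (card_uncert_le_sq _)
      rwa [Fintype.card_fin] at this
    have h2 : (cost G [lastRound] ∅ : ℝ) ≤ n ^ 2 := by exact_mod_cast h1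
    have h3 : (1 : ℝ) ≤ Real.logb 2 n := by
      rw [Real.le_logb_iff_rpow_le one_lt_two (by positivity), Real.rpow_one]
      exact_mod_cast hn
    have h4 : (1 : ℝ) ≤ m := by exact_mod_cast hm
    calc (cost G [lastRound] ∅ : ℝ) ≤ n ^ 2 * 1 * 1 := by linarith
      _ ≤ _ := by gcongr

/-- Both budgets vanish, since log* 1 and log 1 are zero; but there is only one graph on one vertex.
-/
theorem exists_learner_one (C : ℝ) :
    ∃ A : RandomizedLearner (Fin 1), A.IsLasVegas ∧ A.RunsInRounds (logStar 1) ∧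
      ∀ m : ℕ, 1 ≤ m → ∀ G : SimpleGraph (Fin 1), G.edgeSet.ncard ≤ m →
        A.expectedQueries G ≤ ENNReal.ofReal (C * m * Real.logb 2 (1 : ℕ)) := by
  refine ⟨uniformLearner Unit fun _ => [], ?_, ?_, ?_⟩
  · intro G s _
    exact Subsingleton.elim _ _
  · intro G s _
    exact (numRounds_learner _ _ _).trans_le (Nat.zero_le _)
  · intro m _ G _
    rw [expectedQueries_uniformLearner, avg_const]
    simp [cost]

end EdgeQuery

theorem mainTheorem1 :
    ∃ (A : ∀ n : ℕ, RandomizedLearner (Fin n)) (C : ℝ), 0 < C ∧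
      ∀ n : ℕ, 1 ≤ n →
        (A n).IsLasVegas ∧
        (A n).RunsInRounds (logStar n) ∧
        ∀ (m : ℕ), 1 ≤ m → ∀ G : SimpleGraph (Fin n), G.edgeSet.ncard ≤ m →
          (A n).expectedQueries G ≤ ENNReal.ofReal (C * (m : ℝ) * Real.logb 2 (n : ℝ)) := by
  obtain ⟨n₀, hn₀⟩ := EdgeQuery.eventually_le_logStar 10
  -- The first summand pays for the ten-round learner, the second for asking all pairs when `n <
  -- n₀`.
  set C : ℝ := 2 * 10 ^ 18 + (n₀ : ℝ) ^ 2 with hC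
  have key : ∀ n : ℕ, ∃ A : RandomizedLearner (Fin n), 1 ≤ n →
      A.IsLasVegas ∧ A.RunsInRounds (logStar n) ∧
        ∀ (m : ℕ), 1 ≤ m → ∀ G : SimpleGraph (Fin n), G.edgeSet.ncard ≤ m →
          A.expectedQueries G ≤ ENNReal.ofReal (C * (m : ℝ) * Real.logb 2 (n : ℝ)) := by
    intro n
    rcases Nat.lt_or_ge n 2 with hn | hn
    · rcases Nat.lt_or_ge n 1 with h0 | h1
      · exact ⟨EdgeQuery.uniformLearner Unit fun _ => [], fun h => absurd h (by omega)⟩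
      · obtain rfl : n = 1 := by omega
        obtain ⟨A, hA⟩ := EdgeQuery.exists_learner_one C
        exact ⟨A, fun _ => hA⟩
    · have hlog : 0 ≤ Real.logb 2 (n : ℝ) :=
        Real.logb_nonneg one_lt_two (by exact_mod_cast (by omega : 1 ≤ n))
      have hmono : ∀ c : ℝ, c ≤ C → ∀ m : ℕ, ENNReal.ofReal (c * m * Real.logb 2 n)
          ≤ ENNReal.ofReal (C * m * Real.logb 2 n) := fun c hc m =>
        ENNReal.ofReal_le_ofReal (by gcongr)
      rcases Nat.lt_or_ge n n₀ with h | h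
      · obtain ⟨A, h1, h2, h3⟩ := EdgeQuery.exists_learner_of_two_le hn
        refine ⟨A, fun _ => ⟨h1, h2, fun m hm G hG => (h3 m hm G hG).trans (hmono _ ?_ m)⟩⟩
        have : (n : ℝ) ^ 2 ≤ (n₀ : ℝ) ^ 2 := by gcongr
        rw [hC]; linarith
      · obtain ⟨A, h1, h2, h3⟩ := EdgeQuery.exists_learner_of_ten_le_logStar hn (hn₀ n h)
        refine ⟨A, fun _ => ⟨h1, h2, fun m hm G hG => (h3 m hm G hG).trans (hmono _ ?_ m)⟩⟩
        rw [hC]; nlinarith [sq_nonneg (n₀ : ℝ)]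
  choose A hA using key
  exact ⟨A, C, by positivity, hA⟩
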